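/- Let $X\subset\mathbb R^2$ be a polygonal free space: a compact set which is the closure of its interior and whose boundary is the union of finitely many pairwise disjoint simple closed polygons. Let a convex division of $X$ be given: finitely many convex polygons (the cells, closed and with nonempty interior) with pairwise disjoint interiors and union $X$, whose vertices are vertices of the boundary polygons of $X$, and such that any two different cells that share more than one point intersect in a segment (their cutline) whose endpoints are vertices of the boundary polygons. The topology graph has the cells as nodes; two different cells are adjacent if they share a cutline. A path in the graph is a nonempty finite sequence of nodes in which successive entries are adjacent or equal. Two such paths are homotopic if one is obtained from the other by finitely many steps, each of which replaces an entry $\mathrm x$ by $(\mathrm x,\mathrm x)$ or $(\mathrm x,\mathrm y,\mathrm x)$, or conversely, all intermediate sequences being paths. The product $\mathrm f*\mathrm g$ is $\mathrm f$ followed by $\mathrm g$ without its first entry (which is the last entry of $\mathrm f$), and $\bar{\mathrm f}$ is the reversed sequence. A path is a no rollback path if no two successive entries are equal and it is not of the form $\mathrm f_1*\mathrm f_2*\bar{\mathrm f}_2*\mathrm f_3$ with a path $\mathrm f_2$ of at least two entries. Let $x,y\in X$, and fix a cell $\mathrm a$ containing $x$ and a cell $\mathrm b$ containing $y$ (these are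 the only choices unless $x$ or $y$ lies on a cutline). For a path $f:[0,1]\to X$ from $x$ to $y$, let $\Gamma\circ f$ be the sequence of cells that $f$ passes: a graph path $(\mathrm x_1,\dots,\mathrm x_n)$ of minimal length from $\mathrm a$ to $\mathrm b$ for which there are times $0=t_0\le t_1\le\dots\le t_n=1$ with $f([t_{k-1},t_k])\subset \mathrm x_k$ for all $k$ (so a cutline that is only touched, or followed without crossing, does not count as crossed). It is defined if $f$ changes cells only finitely often. Then $\Gamma^*\circ f$ denotes the no rollback path homotopic to $\Gamma\circ f$. The length of a path is the supremum of the lengths of its inscribed polygonal lines. **Theorem.** Let $f$ be a path in $X$ from $x$ to $y$, and let $f^*$ be a shortest path in the homotopy class $[f]$ of $f$ in $X$ (with fixed endpoints). Then $\Gamma\circ f^*$ is defined, unique, and a no rollback path, and $$\Gamma\circ f^*=\Gamma^*\circ g$$ for every $g\in[f]$ for which $\Gamma\circ g$ is defined, where $\Gamma^*\circ g$ is unique; in particular $\Gamma\circ f^*=\Gamma^*\circ f$ if $\Gamma\circ f$ is defined. -/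

import Mathlib

open scoped unitInterval

/-- The Euclidean plane. -/
abbrev Plane : Type := EuclideanSpace ℝ (Fin 2)

/-! ### Polygonal free space -/

/-- A simple polygon: at least three distinct vertices, and two different edges meet only if they
are consecutive, and then only in their common vertex. -/
def IsSimplePolygon {n : ℕ} (P : Polygon Plane n) : Prop :=
  3 ≤ n ∧ Function.Injective P.vertices ∧
    ∀ i j : Fin n, i ≠ j → ∀ p ∈ P.edgeSet ℝ i ∩ P.edgeSet ℝ j,
      (j = finRotate n i ∧ p = P j) ∨ (i = finRotate n j ∧ p = P i)

/-- A bounded polygonal free space: a compact region of the plane (the closure of its interior,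
not necessarily connected, possibly with holes) whose boundary is the union of finitely many
pairwise disjoint simple closed polygons. -/
structure FreeSpace where
  /-- the underlying region -/
  carrier : Set Plane
  isCompact_carrier : IsCompact carrier
  closure_interior_carrier : closure (interior carrier) = carrier
  /-- number of boundary loops -/
  numLoops : ℕ
  /-- number of vertices of a boundary loop -/
  size : Fin numLoops → ℕ
  /-- the boundary loops -/
  loop : (k : Fin numLoops) → Polygon Plane (size k)
  loop_simple : ∀ k, IsSimplePolygon (loop k)
  loop_disjoint : ∀ k₁ k₂, k₁ ≠ k₂ → Disjoint ((loop k₁).boundary ℝ) ((loop k₂).boundary ℝ)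
  frontier_carrier : frontier carrier = ⋃ k, (loop k).boundary ℝ

/-- The vertices of the boundary polygons. -/
def FreeSpace.vertexSet (X : FreeSpace) : Set Plane :=
  ⋃ k, Set.range (X.loop k).vertices

/-- A convex division of a polygonal free space: finitely many nondegenerate convex polygons
(the cells) with disjoint interiors that cover the space; no new vertices are created, and two
cells that share more than one point share a whole cutline, which is a segment
between two vertices of the original boundary polygons. -/
structure ConvexDivision (X : FreeSpace) (ι : Type*) where
  finite_cells : Finite ι
  /-- the convex polygons (closed, i.e. with their boundary) -/
  cell : ι → Set Plane
  cell_polygon : ∀ i, ∃ s : Finset Plane, (s : Set Plane) ⊆ X.vertexSet ∧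
    cell i = convexHull ℝ (s : Set Plane)
  cell_interior_nonempty : ∀ i, (interior (cell i)).Nonempty
  iUnion_cell : ⋃ i, cell i = X.carrier
  cell_disjoint : ∀ i j, i ≠ j → Disjoint (interior (cell i)) (interior (cell j))
  cutline : ∀ i j, i ≠ j → (cell i ∩ cell j).Nontrivial →
    ∃ p ∈ X.vertexSet, ∃ q ∈ X.vertexSet, cell i ∩ cell j = segment ℝ p q

/-- The topology graph: nodes are the cells, edges are the cutlines. -/
def ConvexDivision.graph {X : FreeSpace} {ι : Type*} (D : ConvexDivision X ι) : SimpleGraph ι where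
  Adj i j := i ≠ j ∧ (D.cell i ∩ D.cell j).Nontrivial
  symm := ⟨fun i j h => ⟨h.1.symm, by rw [Set.inter_comm]; exact h.2⟩⟩
  loopless := ⟨fun _ h => h.1 rfl⟩

/-! ### Paths in the topology graph -/

/-- A path in the graph: a nonempty finite sequence of nodes in which successive entries
are adjacent (or equal: repetitions `(x, x)` are allowed). -/
def IsTopoPath {V : Type*} (G : SimpleGraph V) (l : List V) : Prop :=
  l ≠ [] ∧ l.IsChain (fun x y => x = y ∨ G.Adj x y)

/-- `h'` arises from `h` by an extension: an entry `x` is replaced by `(x, x)` or `(x, y, x)`.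
The reverse passage, from `h'` to `h`, is a contraction. -/
def IsExtension {V : Type*} (h h' : List V) : Prop :=
  ∃ (u v : List V) (x : V), h = u ++ [x] ++ v ∧
    (h' = u ++ [x, x] ++ v ∨ ∃ y, h' = u ++ [x, y, x] ++ v)

/-- Path homotopy in the graph: a finite sequence of paths, each obtained from the previous
one by an extension or a contraction (these operations keep the first and the last node). -/
def TopoHomotopic {V : Type*} (G : SimpleGraph V) (f g : List V) : Prop :=
  IsTopoPath G f ∧ Relation.ReflTransGen
    (fun h h' => IsTopoPath G h' ∧ (IsExtension h h' ∨ IsExtension h' h)) f g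

/-- Product of paths: `f` followed by `g` without the first entry of `g`. -/
def topoProd {V : Type*} (f g : List V) : List V := f ++ g.tail

/-- `f` contains a rollback: `f = f₁ * f₂ * f₂⁻¹ * f₃`, where the products are meaningful and `f₂`
is not an identity path (a sequence of length one). -/
def HasRollback {V : Type*} (G : SimpleGraph V) (f : List V) : Prop :=
  ∃ f₁ f₂ f₃ : List V, IsTopoPath G f₁ ∧ IsTopoPath G f₂ ∧ IsTopoPath G f₃ ∧
    f₁.getLast? = f₂.head? ∧ f₂.reverse.getLast? = f₃.head? ∧ 2 ≤ f₂.length ∧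
    f = topoProd (topoProd (topoProd f₁ f₂) f₂.reverse) f₃

/-- A no rollback path: a path without repetitions `(x, x)` and without rollback. -/
def NoRollback {V : Type*} (G : SimpleGraph V) (f : List V) : Prop :=
  IsTopoPath G f ∧ f.IsChain (fun x y => x ≠ y) ∧ ¬ HasRollback G f

/-! ### Shortest paths in a homotopy class -/

/-- Length of a path in the free space (supremum of the lengths of inscribed polygonal lines). -/
noncomputable def pathLength {X : FreeSpace} {x y : X.carrier} (f : Path x y) : ENNReal :=
  eVariationOn (fun t : I => (f t : Plane)) Set.univ

/-- `g` is a path of minimal length in the homotopy class (with fixed endpoints) of `f`. -/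
def IsLocallyOptimal {X : FreeSpace} {x y : X.carrier} (g f : Path x y) : Prop :=
  g.Homotopic f ∧ ∀ h : Path x y, h.Homotopic f → pathLength g ≤ pathLength h

/-! ### The encoders -/

namespace ConvexDivision

variable {X : FreeSpace} {ι : Type*} (D : ConvexDivision X ι) (a b : ι) {x y : X.carrier}

/-- `f` traverses the cells of the graph path `l` from `a` to `b` in this order: there are times
`0 = t 0 ≤ t 1 ≤ ⋯ ≤ t n = 1` such that `f` stays in the `k`-th cell of `l` between `t k` and
`t (k + 1)`. At the time of a change `f` lies in both cells, that is, on their cutline. -/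
def Traverses (f : Path x y) (l : List ι) : Prop :=
  IsTopoPath D.graph l ∧ l.head? = some a ∧ l.getLast? = some b ∧
    ∃ t : ℕ → I, Monotone t ∧ t 0 = 0 ∧ t l.length = 1 ∧
      ∀ (k : ℕ) (hk : k < l.length), ∀ s ∈ Set.Icc (t k) (t (k + 1)), (f s : Plane) ∈ D.cell l[k]

/-- `Γ ∘ f = l`, where `a` and `b` are the nodes of the endpoints of `f`: `l` is the sequence of
cells that `f` passes from time `0` to time `1`. Minimality of the length says that a cell is
listed only if `f` really has to pass it; merely touching a cutline or running along it
without crossing does not count as a passage. -/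
def IsGamma (f : Path x y) (l : List ι) : Prop :=
  D.Traverses a b f l ∧ ∀ l', D.Traverses a b f l' → l.length ≤ l'.length

/-- `Γ* ∘ f = r`: `r` is a no rollback path homotopic to `Γ ∘ f`. -/
def IsGammaStar (f : Path x y) (r : List ι) : Prop :=
  ∃ l, D.IsGamma a b f l ∧ NoRollback D.graph r ∧ TopoHomotopic D.graph l r

end ConvexDivision

/-!
A shortest path and an arbitrary path of the same homotopy class are compared through an invariant
with values in a free group, which determines a no rollback path completely.

*The invariant.* Ordered pairs of different cells are labelled by the letters of a free group, with
inverse letters for opposite pairs. The product of the labels along a graph path (`walkElt`) does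
not change under homotopies in the graph, and a no rollback path yields a reduced word, so that it
is determined by its first cell and this product (`exists_labelling`). It remains to see that the
product is the same for the cell sequences of homotopic paths in the free space, and that the cell
sequences of shortest paths are no rollback paths.

*Homotopy invariance.* The cells containing a given point form a tree in the topology graph. Hence
on these cells the labelling is the difference of a potential (`exists_potential`), and the
potentials define a locally constant sheaf over the free space (`IsSection`): a section assigns to a
point and a cell containing it a group element, and crossing a cutline multiplies by the label of
the crossing. Pulled back along a homotopy, this sheaf has a section over the unit square
(`IsSection.exists_square`). Comparing the section on the two sides of the square shows that both
products agree (`walkElt_eq_of_homotopic`). The intermediate paths of the homotopy may change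
cells infinitely often.

*The cells at a point.* Away from the vertices there are at most two of them, on the two sides of a
cutline (`union_mem_nhds`, `eq_or_eq_of_mem`), because cells have no other extreme points than
vertices. At a vertex, a cell with two neighbours has no boundary points near the vertex except on
the two cutlines; so a family of cells in which each one has two neighbours covers a full
neighbourhood, which is impossible at a boundary point (`exists_leaf`). The cells at a vertex are
connected since near it the boundary of the free space consists of two segments only, while two
families of cells without a common cutline would have at least four boundary rays
(`reflTransGen_star`).

*Shortest paths.* A shortest path has finite length, since every class contains a polygonal path
(`exists_homotopic_pathLength_ne_top`). If it stays in a star-shaped set between two times and the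
segment between the two points lies in this set, then it follows this segment
(`IsLocallyOptimal.mem_segment`). In a star-shaped neighbourhood of a point, the path is therefore
in each cell during a time interval only, so that it passes finitely many cells
(`exists_traverses`). If a cell sequence of it contained `c, d, c`, then the path would follow the
cutline of `c` and `d` during its stay in `d` and would never have to leave `c`, contrary to
minimality (`visits_remove_backtrack`).
-/

/-! ### Words and the free group -/

section Words

variable {V : Type*}

/-- The value of a node sequence under an edge labelling `e` with values in a group: the product of
the labels of its successive pairs. -/
def walkElt {F : Type*} [Group F] (e : V → V → F) : List V → F
  | x :: y :: l => e x y * walkElt e (y :: l)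
  | _ => 1

section Labelling

variable {F : Type*} [Group F] (e : V → V → F)

lemma walkElt_append (u : List V) (x : V) (v : List V) :
    walkElt e (u ++ x :: v) = walkElt e (u ++ [x]) * walkElt e (x :: v) := by
  induction u with
  | nil => simp [walkElt]
  | cons a u ih =>
    cases u with
    | nil => simp [walkElt]
    | cons b u =>
      simp only [List.cons_append, walkElt] at ih ⊢
      rw [ih, mul_assoc]

lemma walkElt_extension (hself : ∀ x, e x x = 1) (hinv : ∀ x y, e x y * e y x = 1)
    {h h' : List V} (hh : IsExtension h h') : walkElt e h = walkElt e h' := by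
  obtain ⟨u, v, x, rfl, rfl | ⟨y, rfl⟩⟩ := hh
  · simp only [List.append_assoc, List.cons_append, List.nil_append]
    rw [walkElt_append, walkElt_append e u x (x :: v)]
    simp [walkElt, hself]
  · simp only [List.append_assoc, List.cons_append, List.nil_append]
    rw [walkElt_append, walkElt_append e u x (y :: x :: v)]
    simp only [walkElt]
    rw [← mul_assoc (e x y), hinv, one_mul]

lemma walkElt_topoHomotopic (G : SimpleGraph V) (hself : ∀ x, e x x = 1)
    (hinv : ∀ x y, e x y * e y x = 1) {f g : List V} (h : TopoHomotopic G f g) :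
    walkElt e f = walkElt e g := by
  obtain ⟨-, h⟩ := h
  induction h with
  | refl => rfl
  | tail _ hs ih =>
    rcases hs.2 with h | h
    · rw [ih, walkElt_extension e hself hinv h]
    · rw [ih, walkElt_extension e hself hinv h]

end Labelling

lemma IsExtension.head?_eq {h h' : List V} (hh : IsExtension h h') : h.head? = h'.head? := by
  obtain ⟨u, v, x, rfl, rfl | ⟨y, rfl⟩⟩ := hh <;> cases u <;> simp

lemma TopoHomotopic.head?_eq {G : SimpleGraph V} {f g : List V} (h : TopoHomotopic G f g) :
    f.head? = g.head? := by
  obtain ⟨-, h⟩ := h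
  induction h with
  | refl => rfl
  | tail _ hs ih =>
    rcases hs.2 with h | h
    · rw [ih, h.head?_eq]
    · rw [ih, h.head?_eq]

/-- The letters of a node sequence in the free group on unordered pairs: each step is an edge
together with its direction with respect to a fixed order of the nodes. -/
def letters [LinearOrder V] : List V → List (Sym2 V × Bool)
  | x :: y :: l => (s(x, y), decide (x < y)) :: letters (y :: l)
  | _ => []

/-- A node sequence can be read off from its first entry and its letters. -/
lemma letters_injective [LinearOrder V] :
    ∀ (l l' : List V), l ≠ [] → l.head? = l'.head? → letters l = letters l' → l = l'
  | [], _, h, _, _ => absurd rfl h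
  | _ :: _, [], _, h, _ => by simp at h
  | [x], [x'], _, h, _ => by simpa using h
  | [x], x' :: y' :: l', _, _, h => by simp [letters] at h
  | x :: y :: l, [x'], _, _, h => by simp [letters] at h
  | x :: y :: l, x' :: y' :: l', _, h1, h => by
    simp only [List.head?_cons, Option.some.injEq] at h1
    subst h1
    simp only [letters, List.cons.injEq, Prod.mk.injEq, Sym2.congr_right] at h
    obtain ⟨⟨rfl, -⟩, h⟩ := h
    rw [letters_injective (y :: l) (y :: l') (by simp) rfl h]

/-- Cancelling letters `{x, y}`, `{y, z}` of opposite directions would mean `x = z`. -/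
lemma isReduced_letters [LinearOrder V] :
    ∀ (l : List V), l.IsChain (fun x y => x ≠ y) → (∀ u x y v, l ≠ u ++ x :: y :: x :: v) →
      FreeGroup.IsReduced (letters l)
  | [], _, _ => by simp [letters]
  | [x], _, _ => by simp [letters]
  | [x, y], _, _ => by simp [letters]
  | x :: y :: z :: l, h, hb => by
    have ih := isReduced_letters (y :: z :: l) (by simp at h ⊢; exact h.2)
      (fun u p q v hv => hb (x :: u) p q v (by rw [hv]; rfl))
    simp only [letters] at ih ⊢
    refine List.isChain_cons_cons.2 ⟨?_, ih⟩
    intro hs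
    simp only [Sym2.eq, Sym2.rel_iff', Prod.mk.injEq, Prod.swap_prod_mk] at hs
    simp only [List.isChain_cons_cons] at h
    rcases hs with ⟨h1, -⟩ | ⟨h1, -⟩
    · exact absurd h1 h.1
    · subst h1
      exact absurd rfl (hb [] x y l)

/-- The free group on the edges of the complete graph labels pairs of nodes in such a way that a
node sequence without repetitions and without turning back is determined by its first entry and
its product of labels. -/
lemma exists_labelling.{u} (V : Type u) : ∃ (F : Type u) (_ : Group F) (e : V → V → F),
    (∀ x, e x x = 1) ∧ (∀ x y, e x y * e y x = 1) ∧
    ∀ l l' : List V, l ≠ [] → l.head? = l'.head? →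
      l.IsChain (fun x y => x ≠ y) → l'.IsChain (fun x y => x ≠ y) →
      (∀ u x y v, l ≠ u ++ x :: y :: x :: v) → (∀ u x y v, l' ≠ u ++ x :: y :: x :: v) →
      walkElt e l = walkElt e l' → l = l' := by
  classical
  obtain ⟨_, -⟩ := exists_wellFoundedLT V
  let e : V → V → FreeGroup (Sym2 V) := fun x y =>
    if x = y then 1 else FreeGroup.mk [(s(x, y), decide (x < y))]
  have hmk : ∀ l : List V, l.IsChain (fun x y => x ≠ y) →
      walkElt e l = FreeGroup.mk (letters l) := by
    intro l
    induction l with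
    | nil => intro _; rfl
    | cons x l ih =>
      cases l with
      | nil => intro _; rfl
      | cons y l =>
        intro h
        rw [List.isChain_cons_cons] at h
        simp only [walkElt, letters]
        rw [ih h.2]
        simp [e, h.1]
  refine ⟨FreeGroup (Sym2 V), inferInstance, e, by simp [e], ?_, ?_⟩
  · intro x y
    by_cases h : x = y
    · simp [e, h]
    · have hne : ¬ y = x := fun h' => h h'.symm
      have : FreeGroup.mk [(s(y, x), decide (y < x))] =
          (FreeGroup.mk [(s(x, y), decide (x < y))])⁻¹ := by
        rw [FreeGroup.inv_mk]
        simp only [FreeGroup.invRev, List.map_cons, List.map_nil, List.reverse_singleton]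
        rw [Sym2.eq_swap]
        congr 3
        rcases lt_or_gt_of_ne h with h1 | h1 <;> simp [h1, not_lt.2 h1.le]
      simp only [e, if_neg h, if_neg hne, this, mul_inv_cancel]
  · intro l l' hne hh hc hc' hb hb' he
    rw [hmk l hc, hmk l' hc'] at he
    refine letters_injective l l' hne hh ?_
    have := congrArg FreeGroup.toWord he
    rwa [FreeGroup.toWord_mk, FreeGroup.toWord_mk, (isReduced_letters l hc hb).reduce_eq,
      (isReduced_letters l' hc' hb').reduce_eq] at this

variable {G : SimpleGraph V}

lemma hasRollback_of_backtrack {u v : List V} {x y : V}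
    (h : IsTopoPath G (u ++ x :: y :: x :: v)) : HasRollback G (u ++ x :: y :: x :: v) := by
  obtain ⟨-, h⟩ := h
  have h1 : (u ++ [x]).IsChain (fun x y => x = y ∨ G.Adj x y) :=
    h.infix ⟨[], y :: x :: v, by simp⟩
  have h2 : [x, y].IsChain (fun x y => x = y ∨ G.Adj x y) := h.infix ⟨u, x :: v, by simp⟩
  have h3 : (x :: v).IsChain (fun x y => x = y ∨ G.Adj x y) := h.infix ⟨u ++ [x, y], [], by simp⟩
  exact ⟨u ++ [x], [x, y], x :: v, ⟨by simp, h1⟩, ⟨by simp, h2⟩, ⟨by simp, h3⟩, by simp,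
    by simp, by simp, by simp [topoProd]⟩

lemma HasRollback.exists_backtrack {f : List V} (h : HasRollback G f) :
    ∃ u x y v, f = u ++ x :: y :: x :: v := by
  obtain ⟨f₁, f₂, f₃, -, -, -, h12, -, h2, rfl⟩ := h
  obtain ⟨w, q, rfl⟩ : ∃ w q, f₂ = w ++ [q] := by
    rcases List.eq_nil_or_concat f₂ with rfl | ⟨w, q, rfl⟩
    · simp at h2
    · exact ⟨w, q, by simp⟩
  obtain ⟨w, p, rfl⟩ : ∃ w' p, w = w' ++ [p] := by
    rcases List.eq_nil_or_concat w with rfl | ⟨w, q, rfl⟩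
    · simp at h2
    · exact ⟨w, q, by simp⟩
  cases w with
  | nil =>
    obtain ⟨f, rfl⟩ : ∃ f, f₁ = f ++ [p] := by
      rcases List.eq_nil_or_concat f₁ with rfl | ⟨w, q, rfl⟩
      · simp at h12
      · simp at h12; exact ⟨w, by simp [h12]⟩
    exact ⟨f, p, q, f₃.tail, by simp [topoProd]⟩
  | cons s w =>
    exact ⟨f₁ ++ w, p, q, w.reverse ++ [s] ++ f₃.tail, by simp [topoProd]⟩

/-- A rollback shows at the turning point of `f₂ * f₂⁻¹` as an entry between two equal ones. -/
lemma noRollback_iff {f : List V} : NoRollback G f ↔ IsTopoPath G f ∧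
    f.IsChain (fun x y => x ≠ y) ∧ ∀ u x y v, f ≠ u ++ x :: y :: x :: v := by
  refine and_congr_right fun h => and_congr_right fun _ => ⟨fun hr u x y v hf => hr ?_, ?_⟩
  · subst hf; exact hasRollback_of_backtrack h
  · intro hb hr
    obtain ⟨u, x, y, v, rfl⟩ := hr.exists_backtrack
    exact hb u x y v rfl

lemma exists_repetition_of_not_isChain_ne {l : List V} (h : ¬ l.IsChain (fun x y => x ≠ y)) :
    ∃ u x v, l = u ++ x :: x :: v := by
  induction l with
  | nil => simp at h
  | cons a l ih =>
    cases l with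
    | nil => simp at h
    | cons b l =>
      by_cases hab : a = b
      · subst hab; exact ⟨[], a, l, rfl⟩
      · rw [List.isChain_cons_cons] at h
        obtain ⟨u, x, v, hu⟩ := ih (fun h' => h ⟨hab, h'⟩)
        exact ⟨a :: u, x, v, by rw [hu]; rfl⟩

lemma IsTopoPath.remove_repetition {u v : List V} {x : V} (h : IsTopoPath G (u ++ x :: x :: v)) :
    IsTopoPath G (u ++ x :: v) := by
  refine ⟨by simp, ?_⟩
  rw [List.isChain_split]
  exact ⟨h.2.infix ⟨[], x :: v, by simp⟩, h.2.infix ⟨u ++ [x], [], by simp⟩⟩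

lemma IsTopoPath.remove_backtrack {u v : List V} {x y : V}
    (h : IsTopoPath G (u ++ x :: y :: x :: v)) : IsTopoPath G (u ++ x :: v) := by
  refine ⟨by simp, ?_⟩
  rw [List.isChain_split]
  exact ⟨h.2.infix ⟨[], y :: x :: v, by simp⟩, h.2.infix ⟨u ++ [x, y], [], by simp⟩⟩

lemma exists_noRollback_topoHomotopic (l : List V) (h : IsTopoPath G l) :
    ∃ r, NoRollback G r ∧ TopoHomotopic G l r := by
  induction hn : l.length using Nat.strong_induction_on generalizing l with
  | _ n ih =>
    by_cases hr : NoRollback G l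
    · exact ⟨l, hr, h, .refl⟩
    have key : ∃ l', IsTopoPath G l' ∧ IsExtension l' l ∧ l'.length < l.length := by
      rw [noRollback_iff] at hr
      by_cases hc : l.IsChain (fun x y => x ≠ y)
      · have : ∃ u x y v, l = u ++ x :: y :: x :: v := by
          by_contra! hcon
          exact hr ⟨h, hc, hcon⟩
        obtain ⟨u, x, y, v, rfl⟩ := this
        exact ⟨u ++ x :: v, h.remove_backtrack, ⟨u, v, x, by simp, .inr ⟨y, by simp⟩⟩, by simp⟩
      · obtain ⟨u, x, v, rfl⟩ := exists_repetition_of_not_isChain_ne hc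
        exact ⟨u ++ x :: v, h.remove_repetition, ⟨u, v, x, by simp, .inl (by simp)⟩, by simp⟩
    obtain ⟨l', hl', he, hlt⟩ := key
    obtain ⟨r, hr, ht⟩ := ih l'.length (hn ▸ hlt) l' hl' rfl
    exact ⟨r, hr, h, ht.2.head ⟨hl', .inr he⟩⟩

end Words

/-! ### Locally constant sections and homotopy invariance -/

open Set Filter Topology

section Monodromy

/-- The curve `p` visits the sets `cell c` for the entries `c` of the list one after another
between the times `s` and `e`. -/
def Visits {E ι : Type*} (cell : ι → Set E) (p : I → E) : List ι → I → I → Prop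
  | [], s, e => s = e
  | c :: l, s, e => ∃ m, s ≤ m ∧ (∀ r ∈ Icc s m, p r ∈ cell c) ∧ Visits cell p l m e

variable {E T ι F : Type*} [TopologicalSpace T] [Group F]

/-- A section of the locally constant sheaf given by the potentials `φ`, pulled back along
`H` to `S`: at each `u ∈ S` it assigns a group element to every cell containing `H u`. Changing
the cell multiplies by the difference of the potentials, moving within a cell changes nothing. The
condition `H u ∈ cell c` in `locConst` says that no new cells appear near `u`. -/
structure IsSection (cell : ι → Set E) (φ : E → ι → F) (H : T → E) (S : Set T)
    (L : T → ι → F) : Prop where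
  transition : ∀ u ∈ S, ∀ c c', H u ∈ cell c → H u ∈ cell c' →
    (L u c)⁻¹ * L u c' = (φ (H u) c)⁻¹ * φ (H u) c'
  locConst : ∀ u ∈ S, ∀ᶠ u' in 𝓝[S] u, ∀ c, H u' ∈ cell c → H u ∈ cell c ∧ L u' c = L u c

variable {cell : ι → Set E} {φ : E → ι → F} {H : T → E} {S S' : Set T} {L L' : T → ι → F}

lemma eqOn_of_locallyConstant {β : Type*} {d : T → β} (hS : IsPreconnected S)
    (hd : ∀ u ∈ S, ∀ᶠ u' in 𝓝[S] u, d u' = d u) : ∀ u ∈ S, ∀ v ∈ S, d u = d v := by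
  let _ : TopologicalSpace β := ⊥
  have _ : DiscreteTopology β := ⟨rfl⟩
  have hc : ContinuousOn d S := fun u hu => by
    refine ContinuousWithinAt.congr_of_eventuallyEq (f := fun _ => d u)
      continuousWithinAt_const (hd u hu) rfl
  exact fun u hu v hv => hS.constant hc hu hv

namespace IsSection

lemma mono (h : IsSection cell φ H S L) (hS : S' ⊆ S) : IsSection cell φ H S' L :=
  ⟨fun u hu => h.transition u (hS hu),
    fun u hu => (h.locConst u (hS hu)).filter_mono (nhdsWithin_mono _ hS)⟩

lemma mul_left (h : IsSection cell φ H S L) (g : F) :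
    IsSection cell φ H S (fun u c => g * L u c) :=
  ⟨fun u hu c c' hc hc' => by
      rw [← h.transition u hu c c' hc hc', mul_inv_rev, mul_assoc, inv_mul_cancel_left],
    fun u hu => (h.locConst u hu).mono fun u' hu' c hc =>
      ⟨(hu' c hc).1, by rw [(hu' c hc).2]⟩⟩

/-- Where only cells containing `z` occur, the potential of `z` is a section. -/
lemma of_star (z : E)
    (hφ : ∀ z z' c c', z ∈ cell c → z ∈ cell c' → z' ∈ cell c → z' ∈ cell c' →
      (φ z c)⁻¹ * φ z c' = (φ z' c)⁻¹ * φ z' c')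
    (hloc : ∀ u, ∀ᶠ u' in 𝓝 u, ∀ c, H u' ∈ cell c → H u ∈ cell c)
    (hS : ∀ u ∈ S, ∀ c, H u ∈ cell c → z ∈ cell c) :
    IsSection cell φ H S (fun _ c => φ z c) :=
  ⟨fun u hu c c' hc hc' => hφ _ _ _ _ (hS u hu c hc) (hS u hu c' hc') hc hc',
    fun u _ => ((hloc u).filter_mono nhdsWithin_le_nhds).mono fun _ h c hc => ⟨h c hc, rfl⟩⟩

/-- On a connected set two sections differ by a constant left factor. -/
lemma exists_eq_mul (h : IsSection cell φ H S L) (h' : IsSection cell φ H S L')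
    (hS : IsPreconnected S) (hcov : ∀ u, ∃ c, H u ∈ cell c) :
    ∃ g, ∀ u ∈ S, ∀ c, H u ∈ cell c → L' u c = g * L u c := by
  choose k hk using hcov
  -- the quotient of the sections does not depend on the cell
  have hd : ∀ u ∈ S, ∀ c, H u ∈ cell c → L' u c * (L u c)⁻¹ = L' u (k u) * (L u (k u))⁻¹ := by
    intro u hu c hc
    have h1 := h.transition u hu c (k u) hc (hk u)
    rw [← h'.transition u hu c (k u) hc (hk u)] at h1
    have h2 : L u (k u) = L u c * ((L' u c)⁻¹ * L' u (k u)) := by rw [← h1]; group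
    rw [h2]; group
  rcases S.eq_empty_or_nonempty with rfl | ⟨u₀, hu₀⟩
  · exact ⟨1, by simp⟩
  refine ⟨L' u₀ (k u₀) * (L u₀ (k u₀))⁻¹, fun u hu c hc => ?_⟩
  rw [← mul_inv_eq_iff_eq_mul, hd u hu c hc]
  refine eqOn_of_locallyConstant (d := fun u => L' u (k u) * (L u (k u))⁻¹) hS ?_ u hu u₀ hu₀
  intro v hv
  filter_upwards [h.locConst v hv, h'.locConst v hv] with u h1 h2
  rw [← hd v hv (k u) (h1 _ (hk u)).1, (h1 _ (hk u)).2, (h2 _ (hk u)).2]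

open Classical in
lemma glue (h : IsSection cell φ H S L) (h' : IsSection cell φ H S' L') (hS : IsClosed S)
    (hS' : IsClosed S') (heq : ∀ u ∈ S ∩ S', ∀ c, H u ∈ cell c → L' u c = L u c) :
    IsSection cell φ H (S ∪ S') (fun u c => if u ∈ S then L u c else L' u c) := by
  have h1 : ∀ u ∈ S', ∀ c, H u ∈ cell c → (if u ∈ S then L u c else L' u c) = L' u c := by
    intro u hu c hc
    split_ifs with hs
    · exact (heq u ⟨hs, hu⟩ c hc).symm
    · rfl
  refine ⟨fun u hu c c' hc hc' => ?_, fun u hu => ?_⟩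
  · by_cases hs : u ∈ S
    · simpa [hs] using h.transition u hs c c' hc hc'
    · simpa [hs] using h'.transition u (hu.resolve_left hs) c c' hc hc'
  · rw [nhdsWithin_union, eventually_sup]
    constructor
    · by_cases hs : u ∈ S
      · filter_upwards [h.locConst u hs, self_mem_nhdsWithin] with v hv hvs c hc
        simpa [hs, hvs] using hv c hc
      · rw [notMem_closure_iff_nhdsWithin_eq_bot.1 (by rwa [hS.closure_eq])]
        exact eventually_bot
    · by_cases hs : u ∈ S'
      · filter_upwards [h'.locConst u hs, self_mem_nhdsWithin] with v hv hvs c hc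
        refine ⟨(hv c hc).1, ?_⟩
        rw [h1 v hvs c hc, h1 u hs c (hv c hc).1, (hv c hc).2]
      · rw [notMem_closure_iff_nhdsWithin_eq_bot.1 (by rwa [hS'.closure_eq])]
        exact eventually_bot

lemma exists_union (h : IsSection cell φ H S L) (h' : IsSection cell φ H S' L') (hS : IsClosed S)
    (hS' : IsClosed S') (hc : IsPreconnected (S ∩ S')) (hcov : ∀ u, ∃ c, H u ∈ cell c) :
    ∃ L'', IsSection cell φ H (S ∪ S') L'' := by
  obtain ⟨g, hg⟩ := (h'.mono inter_subset_right).exists_eq_mul (h.mono inter_subset_left) hc hcov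
  exact ⟨_, h.glue (h'.mul_left g) hS hS' fun u hu c hc => (hg u hu c hc).symm⟩

/-- Over the unit square sections exist: those on the small squares of a fine grid are glued. -/
lemma exists_square {H : I × I → E}
    (hφ : ∀ z z' c c', z ∈ cell c → z ∈ cell c' → z' ∈ cell c → z' ∈ cell c' →
      (φ z c)⁻¹ * φ z c' = (φ z' c)⁻¹ * φ z' c')
    (hloc : ∀ u, ∀ᶠ u' in 𝓝 u, ∀ c, H u' ∈ cell c → H u ∈ cell c)
    (hcov : ∀ u, ∃ c, H u ∈ cell c) : ∃ L, IsSection cell φ H univ L := by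
  obtain ⟨t, ht0, htm, ⟨N, hN⟩, ht⟩ := exists_monotone_Icc_subset_open_cover_unitInterval_prod_self
    (c := fun z : I × I => interior {u | ∀ c, H u ∈ cell c → H z ∈ cell c})
    (fun _ => isOpen_interior) (fun u _ => mem_iUnion.2 ⟨u, mem_interior_iff_mem_nhds.2 (hloc u)⟩)
  have hsq : ∀ n m, ∃ L, IsSection cell φ H (Icc (t n) (t (n+1)) ×ˢ Icc (t m) (t (m+1))) L := by
    intro n m
    obtain ⟨z, hz⟩ := ht n m
    exact ⟨_, of_star (H z) hφ hloc fun u hu => interior_subset (hz hu)⟩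
  have hIcc : ∀ n, Icc 0 (t n) ∪ Icc (t n) (t (n+1)) = Icc 0 (t (n+1)) := fun n =>
    Icc_union_Icc_eq_Icc (by rw [← ht0]; exact htm (Nat.zero_le n)) (htm n.le_succ)
  have hIcc' : ∀ n, Icc 0 (t n) ∩ Icc (t n) (t (n+1)) = {t n} := fun n => by
    rw [Icc_inter_Icc_eq_singleton (by rw [← ht0]; exact htm (Nat.zero_le n)) (htm n.le_succ)]
  have hrow : ∀ m n, ∃ L, IsSection cell φ H (Icc 0 (t n) ×ˢ Icc (t m) (t (m+1))) L := by
    intro m n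
    induction n with
    | zero =>
      obtain ⟨L, hL⟩ := hsq 0 m
      exact ⟨L, hL.mono (prod_mono_left (by rw [ht0]; exact Icc_subset_Icc_right bot_le))⟩
    | succ n ih =>
      obtain ⟨L, hL⟩ := ih
      obtain ⟨L', hL'⟩ := hsq n m
      rw [← hIcc, union_prod]
      refine hL.exists_union hL' (isClosed_Icc.prod isClosed_Icc) (isClosed_Icc.prod isClosed_Icc)
        ?_ hcov
      rw [← inter_prod, hIcc']
      exact isPreconnected_singleton.prod isPreconnected_Icc
  have hcol : ∀ m, ∃ L, IsSection cell φ H (Icc 0 1 ×ˢ Icc 0 (t m)) L := by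
    intro m
    induction m with
    | zero =>
      obtain ⟨L, hL⟩ := hrow 0 N
      rw [hN N le_rfl] at hL
      exact ⟨L, hL.mono (prod_mono_right (by rw [ht0]; exact Icc_subset_Icc_right bot_le))⟩
    | succ n ih =>
      obtain ⟨L, hL⟩ := ih
      obtain ⟨L', hL'⟩ := hrow n N
      rw [hN N le_rfl] at hL'
      rw [← hIcc, prod_union]
      refine hL.exists_union hL' (isClosed_Icc.prod isClosed_Icc) (isClosed_Icc.prod isClosed_Icc)
        ?_ hcov
      rw [← prod_inter, hIcc']
      exact isPreconnected_Icc.prod isPreconnected_singleton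
  obtain ⟨L, hL⟩ := hcol N
  refine ⟨L, hL.mono fun u _ => ?_⟩
  rw [hN N le_rfl]
  exact ⟨⟨bot_le, le_top⟩, ⟨bot_le, le_top⟩⟩

/-- A section is constant along a curve that stays in one cell. -/
lemma eq_of_forall_mem (h : IsSection cell φ H univ L) {α : I → T} (hα : Continuous α) {s m : I}
    (hsm : s ≤ m) {c : ι} (hc : ∀ r ∈ Icc s m, H (α r) ∈ cell c) : L (α m) c = L (α s) c := by
  refine eqOn_of_locallyConstant (d := fun r => L (α r) c) (isPreconnected_Icc (a := s) (b := m))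
    (fun u hu => ?_) m (right_mem_Icc.2 hsm) s (left_mem_Icc.2 hsm)
  have := h.locConst (α u) (mem_univ _)
  rw [nhdsWithin_univ] at this
  filter_upwards [(hα.continuousAt.eventually this).filter_mono nhdsWithin_le_nhds,
    self_mem_nhdsWithin] with v hv hvs
  exact (hv c (hc v hvs)).2

/-- Along a curve that passes the cells of a graph path, a section is multiplied by the product of
the labels of this graph path. -/
lemma eq_mul_walkElt {G : SimpleGraph ι} {e : ι → ι → F} (hself : ∀ x, e x x = 1)
    (he : ∀ z c c', G.Adj c c' → z ∈ cell c → z ∈ cell c' → e c c' = (φ z c)⁻¹ * φ z c')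
    (h : IsSection cell φ H univ L) {α : I → T} (hα : Continuous α) :
    ∀ (l : List ι) (s f : I) (a b : ι), IsTopoPath G l → l.head? = some a → l.getLast? = some b →
      Visits cell (fun r => H (α r)) l s f → L (α f) b = L (α s) a * walkElt e l
  | [], _, _, _, _, hp, _, _, _ => absurd rfl hp.1
  | [x], s, f, a, b, _, ha, hb, hv => by
    obtain ⟨m, hsm, hm, rfl⟩ := hv
    simp only [List.head?_cons, Option.some.injEq, List.getLast?_singleton] at ha hb
    subst ha hb
    simpa [walkElt] using h.eq_of_forall_mem hα hsm hm
  | x :: y :: l, s, f, a, b, hp, ha, hb, hv => by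
    obtain ⟨m, hsm, hm, hv⟩ := hv
    simp only [List.head?_cons, Option.some.injEq] at ha
    subst ha
    have hp' := List.isChain_cons_cons.1 hp.2
    have hy : H (α m) ∈ cell y := by
      obtain ⟨m', hmm', hm', -⟩ := hv
      exact hm' m (left_mem_Icc.2 hmm')
    rw [eq_mul_walkElt hself he h hα (y :: l) m f y b ⟨by simp, hp'.2⟩ rfl (by simpa using hb) hv,
      walkElt, ← h.eq_of_forall_mem hα hsm hm, ← mul_assoc]
    congr 1
    have hx := hm m (right_mem_Icc.2 hsm)
    rcases hp'.1 with rfl | hadj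
    · rw [hself, mul_one]
    · rw [he _ _ _ hadj hx hy, ← h.transition _ (mem_univ _) _ _ hx hy, mul_inv_cancel_left]

end IsSection

/-- Homotopy invariance of the product of labels: on a locally finite cover with compatible
potentials it is the same for homotopic curves. -/
lemma walkElt_eq_of_homotopic [TopologicalSpace E] {G : SimpleGraph ι} {e : ι → ι → F}
    (hself : ∀ x, e x x = 1)
    (he : ∀ z c c', G.Adj c c' → z ∈ cell c → z ∈ cell c' → e c c' = (φ z c)⁻¹ * φ z c')
    (hφ : ∀ z z' c c', z ∈ cell c → z ∈ cell c' → z' ∈ cell c → z' ∈ cell c' →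
      (φ z c)⁻¹ * φ z c' = (φ z' c)⁻¹ * φ z' c')
    (hloc : ∀ z : E, ∀ᶠ z' in 𝓝 z, ∀ c, z' ∈ cell c → z ∈ cell c)
    (hcov : ∀ z, ∃ c, z ∈ cell c) {x y : E} {p q : Path x y} (hpq : p.Homotopic q)
    {a b : ι} (ha : x ∈ cell a) (hb : y ∈ cell b) {l l' : List ι}
    (hl : IsTopoPath G l) (hla : l.head? = some a) (hlb : l.getLast? = some b)
    (hl' : IsTopoPath G l') (hla' : l'.head? = some a) (hlb' : l'.getLast? = some b)
    (hv : Visits cell p l 0 1) (hv' : Visits cell q l' 0 1) : walkElt e l = walkElt e l' := by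
  obtain ⟨H⟩ := hpq
  obtain ⟨L, hL⟩ := IsSection.exists_square (H := H) hφ
    (fun u => H.continuous.continuousAt.eventually (hloc _)) fun u => hcov _
  have h1 := hL.eq_mul_walkElt hself he (α := fun r => (0, r)) (by fun_prop) l 0 1 a b hl hla hlb
    (by simpa using hv)
  have h2 := hL.eq_mul_walkElt hself he (α := fun r => (1, r)) (by fun_prop) l' 0 1 a b hl' hla'
    hlb' (by simpa using hv')
  have h3 := hL.eq_of_forall_mem (α := fun r => (r, 0)) (by fun_prop) (s := 0) (m := 1) zero_le_one
    (c := a) (fun r _ => by simpa using ha)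
  have h4 := hL.eq_of_forall_mem (α := fun r => (r, 1)) (by fun_prop) (s := 0) (m := 1) zero_le_one
    (c := b) (fun r _ => by simpa using hb)
  rw [h1, h2, h3] at h4
  exact (mul_left_cancel h4).symm

end Monodromy

/-! ### Convex sets in the plane -/

section PlaneGeometry

/-- The determinant of two vectors of the plane. -/
def planeDet (v w : Plane) : ℝ := v 0 * w 1 - v 1 * w 0

@[fun_prop]
lemma continuous_planeDet {T : Type*} [TopologicalSpace T] {f g : T → Plane} (hf : Continuous f)
    (hg : Continuous g) : Continuous fun t => planeDet (f t) (g t) := by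
  unfold planeDet; fun_prop

/-- Cramer's rule: the coordinates of `v` in the basis `e₁, e₂`. -/
lemma eq_coords {e₁ e₂ : Plane} (h : planeDet e₁ e₂ ≠ 0) (v : Plane) :
    v = (planeDet v e₂ / planeDet e₁ e₂) • e₁ + (planeDet e₁ v / planeDet e₁ e₂) • e₂ := by
  ext i
  fin_cases i <;> simp <;> field_simp <;> unfold planeDet <;> ring

lemma exists_smul_of_planeDet_eq_zero {e₁ e₂ : Plane} (h₁ : e₁ ≠ 0) (h : planeDet e₁ e₂ = 0) :
    ∃ k : ℝ, e₂ = k • e₁ := by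
  unfold planeDet at h
  by_cases h0 : e₁ 0 = 0
  · have h1 : e₁ 1 ≠ 0 := fun h1 => h₁ (by ext i; fin_cases i <;> simp [h0, h1])
    refine ⟨e₂ 1 / e₁ 1, ?_⟩
    ext i
    fin_cases i
    · simp only [h0, zero_mul, zero_sub, neg_eq_zero, mul_eq_zero, h1, false_or] at h
      simp [h, h0]
    · simp; field_simp
  · refine ⟨e₂ 0 / e₁ 0, ?_⟩
    ext i
    fin_cases i
    · simp; field_simp
    · simp; field_simp; linarith

lemma map_eq_zero_of_planeDet_ne_zero {e₁ e₂ : Plane} (h : planeDet e₁ e₂ ≠ 0)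
    (f : StrongDual ℝ Plane) (h₁ : f e₁ = 0) (h₂ : f e₂ = 0) (v : Plane) : f v = 0 := by
  rw [eq_coords h v, map_add, map_smul, map_smul, h₁, h₂]; simp

/-- A convex set containing a triangle contains a half disc around each inner point of a side. -/
lemma eventually_mem_of_openSegment {C : Set Plane} (hC : Convex ℝ C) {p q v w : Plane}
    (hp : p ∈ C) (hq : q ∈ C) (hv : v ∈ C) (hpq : p ≠ q) (hw : w ∈ openSegment ℝ p q)
    (f : StrongDual ℝ Plane) (hfp : f p = f w) (hfq : f q = f w) (hfv : f v < f w) :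
    ∀ᶠ w' in 𝓝 w, f w' ≤ f w → w' ∈ C := by
  obtain ⟨a, b, ha, hb, hab, rfl⟩ := hw
  set w := a • p + b • q with hw
  have hdet : planeDet (q - p) (v - w) ≠ 0 := by
    intro h0
    obtain ⟨k, hk⟩ := exists_smul_of_planeDet_eq_zero (sub_ne_zero.2 hpq.symm) h0
    have := congrArg f hk
    rw [map_smul, map_sub, map_sub, hfp, hfq] at this
    simp at this
    linarith
  set δ := planeDet (q - p) (v - w) with hδ
  -- the coordinates of `w'` with respect to the origin `w` and the basis `q - p, v - w` tend to
  -- zero, and the second one is nonnegative on the half plane of `v`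
  have hα : Tendsto (fun w' => planeDet (w' - w) (v - w) / δ) (𝓝 w) (𝓝 0) := by
    have : Continuous fun w' => planeDet (w' - w) (v - w) / δ := by fun_prop
    simpa [planeDet] using this.tendsto w
  have hβ : Tendsto (fun w' => planeDet (q - p) (w' - w) / δ) (𝓝 w) (𝓝 0) := by
    have : Continuous fun w' => planeDet (q - p) (w' - w) / δ := by fun_prop
    simpa [planeDet] using this.tendsto w
  have h1 := ((hβ.const_sub 1).mul_const a).sub hα
  have h2 := ((hβ.const_sub 1).mul_const b).add hα
  simp only [sub_zero, one_mul, add_zero] at h1 h2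
  filter_upwards [h1.eventually (lt_mem_nhds ha), h2.eventually (lt_mem_nhds hb)]
    with w' h1 h2 hfw'
  have hco := eq_coords hdet (w' - w)
  rw [← hδ] at hco
  set α := planeDet (w' - w) (v - w) / δ
  set β := planeDet (q - p) (w' - w) / δ
  have hβ0 : 0 ≤ β := by
    have := congrArg f hco
    simp only [map_add, map_smul, map_sub, hfp, hfq, sub_self, smul_eq_mul, mul_zero,
      zero_add] at this
    by_contra! hneg
    nlinarith
  have : w' = ((1 - β) * a - α) • p + ((1 - β) * b + α) • q + β • v := by
    have h3 : w' = w + (w' - w) := by abel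
    rw [h3, hco, hw]
    module
  have hs : ((1 - β) * a - α) + ((1 - β) * b + α) + β = 1 := by
    have : b = 1 - a := by linarith
    subst this; ring
  rw [this]
  have := hC.sum_mem (t := Finset.univ) (w := ![(1 - β) * a - α, (1 - β) * b + α, β])
    (z := ![p, q, v]) (by intro i _; fin_cases i <;> simp <;> linarith)
    (by simp [Fin.sum_univ_three]; linarith) (by intro i _; fin_cases i <;> simp [hp, hq, hv])
  simpa [Fin.sum_univ_three] using this

lemma disjoint_interior_of_disjoint {A B : Set Plane} (hB : Convex ℝ B)
    (hB' : (interior B).Nonempty) (h : Disjoint (interior A) (interior B)) :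
    Disjoint (interior A) B := by
  have h1 := h.closure_right isOpen_interior
  rw [hB.closure_interior_eq_closure_of_nonempty_interior hB'] at h1
  exact h1.mono_right subset_closure

/-- Extreme points of a convex hull belong to the generating set. -/
lemma exists_openSegment_of_notMem {s : Set Plane} {w : Plane} (hw : w ∈ convexHull ℝ s)
    (hws : w ∉ s) : ∃ p ∈ convexHull ℝ s, ∃ q ∈ convexHull ℝ s, p ≠ q ∧ w ∈ openSegment ℝ p q := by
  by_contra! hcon
  refine hws (extremePoints_convexHull_subset (𝕜 := ℝ) ?_)
  rw [mem_extremePoints]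
  refine ⟨hw, fun p hp q hq hpq => ?_⟩
  by_cases h : p = q
  · subst h
    rw [openSegment_same, mem_singleton_iff] at hpq
    exact ⟨hpq.symm, hpq.symm⟩
  · exact absurd hpq (hcon p hp q hq h)

/-- A supporting functional at a point outside the interior of a convex set. -/
lemma exists_supporting {C : Set Plane} (hC : Convex ℝ C) (hC' : (interior C).Nonempty)
    {w : Plane} (hw : w ∉ interior C) : ∃ f : StrongDual ℝ Plane,
      (∀ a ∈ interior C, f a < f w) ∧ ∀ a ∈ C, f a ≤ f w := by
  obtain ⟨f, hf⟩ := geometric_hahn_banach_open_point hC.interior isOpen_interior hw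
  refine ⟨f, hf, fun a ha => ?_⟩
  have h1 : a ∈ closure (interior C) := by
    rw [hC.closure_interior_eq_closure_of_nonempty_interior hC']; exact subset_closure ha
  exact closure_minimal (fun b hb => (hf b hb).le)
    (isClosed_le f.continuous continuous_const) h1

lemma map_eq_of_openSegment {f : StrongDual ℝ Plane} {p q w : Plane} (hw : w ∈ openSegment ℝ p q)
    (hp : f p ≤ f w) (hq : f q ≤ f w) : f p = f w ∧ f q = f w := by
  obtain ⟨a, b, ha, hb, hab, rfl⟩ := hw
  obtain rfl : a = 1 - b := by linarith
  simp only [map_add, map_smul, smul_eq_mul] at *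
  have h1 : f p ≤ f q := le_of_mul_le_mul_left (by linarith) hb
  have h2 : f q ≤ f p := le_of_mul_le_mul_left (by linarith) ha
  have h3 := le_antisymm h1 h2
  rw [h3]
  constructor <;> ring

lemma eventually_smul_add (w d : Plane) {P : Plane → Prop} (h : ∀ᶠ w' in 𝓝 w, P w') :
    ∀ᶠ ε in 𝓝[>] (0 : ℝ), P (w + ε • d) := by
  have : Tendsto (fun ε : ℝ => w + ε • d) (𝓝 0) (𝓝 w) := by
    have hc : Continuous fun ε : ℝ => w + ε • d := by fun_prop
    simpa using hc.tendsto 0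
  exact (this.eventually h).filter_mono nhdsWithin_le_nhds

/-- Two convex sets with disjoint interiors meeting at a point that is extreme in neither of them
lie on different sides of a line there, and together they cover a neighbourhood. -/
lemma union_mem_nhds_of_openSegment {C C' : Set Plane} (hC : Convex ℝ C) (hC' : Convex ℝ C')
    (hi : (interior C).Nonempty) (hi' : (interior C').Nonempty)
    (hd : Disjoint (interior C) (interior C')) {w p q p' q' : Plane} (hw' : w ∈ C')
    (hp : p ∈ C) (hq : q ∈ C) (hpq : p ≠ q) (hw : w ∈ openSegment ℝ p q)
    (hp' : p' ∈ C') (hq' : q' ∈ C') (hpq' : p' ≠ q') (hw2 : w ∈ openSegment ℝ p' q') :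
    C ∪ C' ∈ 𝓝 w ∧ (C ∩ C').Nontrivial := by
  have hdis := disjoint_interior_of_disjoint hC' hi' hd
  have hwi : w ∉ interior C := fun h => hdis.le_bot ⟨h, hw'⟩
  obtain ⟨f, hf, hf'⟩ := exists_supporting hC hi hwi
  obtain ⟨v, hv⟩ := hi
  obtain ⟨hfp, hfq⟩ := map_eq_of_openSegment hw (hf' p hp) (hf' q hq)
  have hE := eventually_mem_of_openSegment hC hp hq (interior_subset hv) hpq hw f hfp hfq (hf v hv)
  have hE2 : ∀ᶠ w' in 𝓝 w, f w' < f w → w' ∈ interior C := by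
    filter_upwards [hE.eventually_nhds] with w' hw' hlt
    rw [mem_interior_iff_mem_nhds]
    filter_upwards [hw', f.continuous.continuousAt.eventually (gt_mem_nhds hlt)] with a h1 h2
    exact h1 h2.le
  -- the half disc of `C` at `w` keeps `C'` on the other side of the line
  have hge : ∀ u ∈ C', f w ≤ f u := by
    intro u hu
    by_contra! hlt
    have h1 := eventually_smul_add w (u - w) hE2
    obtain ⟨ε, h1, h2, h3⟩ := (h1.and (Ioo_mem_nhdsGT (zero_lt_one' ℝ))).exists
    refine hdis.le_bot ⟨h1 ?_, hC'.add_smul_sub_mem hw' hu ⟨h2.le, h3.le⟩⟩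
    rw [map_add, map_smul, map_sub, smul_eq_mul]
    nlinarith
  have hge' : ∃ u ∈ C', f w < f u := by
    obtain ⟨u, hu⟩ := hi'
    have h1 := eventually_smul_add u (v - w) (isOpen_interior.mem_nhds hu)
    obtain ⟨ε, h1, h2⟩ := (h1.and self_mem_nhdsWithin).exists
    refine ⟨u, interior_subset hu, ?_⟩
    have h3 := hge _ (interior_subset h1)
    rw [map_add, map_smul, map_sub, smul_eq_mul] at h3
    have h4 := hf v hv
    have h2' : 0 < ε := h2
    nlinarith
  obtain ⟨u, hu, hfu⟩ := hge'
  obtain ⟨h1, h2⟩ := map_eq_of_openSegment (f := -f) hw2 (by simpa using hge p' hp')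
    (by simpa using hge q' hq')
  have hE' := eventually_mem_of_openSegment hC' hp' hq' hu hpq' hw2 (-f) h1 h2 (by simpa using hfu)
  refine ⟨?_, w, ⟨?_, hw'⟩, ?_⟩
  · filter_upwards [hE, hE'] with a ha ha'
    rcases le_total (f a) (f w) with h | h
    · exact .inl (ha h)
    · exact .inr (ha' (by simpa using h))
  · exact hC.openSegment_subset hp hq hw
  · obtain ⟨ε, ⟨h3, h4⟩, h5⟩ :=
      ((eventually_smul_add w (q - p) (hE.and hE')).and self_mem_nhdsWithin).exists
    have hfe : f (w + ε • (q - p)) = f w := by simp [hfp, hfq]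
    refine ⟨w + ε • (q - p), ⟨h3 hfe.le, h4 (by simp [hfp, hfq])⟩, ?_⟩
    have h5' : ε ≠ 0 := ne_of_gt h5
    simp [h5', sub_eq_zero, hpq.symm]

/-- A convex set with two boundary segments from `z` in different directions has no other boundary
points near `z`. -/
lemma eventually_mem_segment_of_notMem_interior {C : Set Plane} (hC : Convex ℝ C)
    (hi : (interior C).Nonempty) {z w₁ w₂ : Plane} (hz : z ∈ C) (h₁ : w₁ ∈ C) (h₂ : w₂ ∈ C)
    (hz₁ : w₁ ≠ z) (hz₂ : w₂ ≠ z) (hm₁ : midpoint ℝ z w₁ ∉ interior C)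
    (hm₂ : midpoint ℝ z w₂ ∉ interior C) (hray : ¬ SameRay ℝ (w₁ - z) (w₂ - z)) :
    ∀ᶠ w in 𝓝 z, w ∈ C → w ∉ interior C → w ∈ segment ℝ z w₁ ∪ segment ℝ z w₂ := by
  have hopen : ∀ w, midpoint ℝ z w ∈ openSegment ℝ z w := fun w =>
    ⟨1 / 2, 1 / 2, by norm_num, by norm_num, by norm_num, by
      rw [midpoint_eq_smul_add, smul_add]; norm_num⟩
  have hseg : ∀ (w : Plane) (t : ℝ), 0 ≤ t → t ≤ 1 → z + t • (w - z) ∈ segment ℝ z w :=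
    fun w t h0 h1 => by rw [segment_eq_image']; exact ⟨t, ⟨h0, h1⟩, rfl⟩
  obtain ⟨v, hv⟩ := hi
  obtain ⟨f, hf, hf'⟩ := exists_supporting hC ⟨v, hv⟩ hm₁
  obtain ⟨g, hg, hg'⟩ := exists_supporting hC ⟨v, hv⟩ hm₂
  obtain ⟨hfz, hfw⟩ := map_eq_of_openSegment (hopen w₁) (hf' z hz) (hf' w₁ h₁)
  obtain ⟨hgz, hgw⟩ := map_eq_of_openSegment (hopen w₂) (hg' z hz) (hg' w₂ h₂)
  rw [← hfz] at hf hf' hfw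
  rw [← hgz] at hg hg' hgw
  set e₁ := w₁ - z with he₁
  set e₂ := w₂ - z with he₂
  have hfe : f e₁ = 0 := by simp [he₁, hfw]
  have hge : g e₂ = 0 := by simp [he₂, hgw]
  have he₁0 : e₁ ≠ 0 := sub_ne_zero.2 hz₁
  have he₂0 : e₂ ≠ 0 := sub_ne_zero.2 hz₂
  by_cases hdet : planeDet e₁ e₂ = 0
  -- opposite directions: near `z` the set is a half disc
  · obtain ⟨k, hk⟩ := exists_smul_of_planeDet_eq_zero he₁0 hdet
    have hkneg : k < 0 := by
      by_contra! hk0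
      exact hray (hk ▸ SameRay.sameRay_nonneg_smul_right e₁ hk0)
    have hz12 : z ∈ openSegment ℝ w₁ w₂ := by
      refine ⟨-k / (1 - k), 1 / (1 - k), by apply div_pos <;> linarith,
        by apply div_pos <;> linarith, by rw [← add_div]; rw [div_eq_one_iff_eq] <;> linarith, ?_⟩
      have hw2 : w₂ = z + k • (w₁ - z) := by rw [← he₁, ← hk, he₂]; abel
      have hk1 : (1 : ℝ) - k ≠ 0 := by linarith
      rw [hw2]
      ext i
      simp only [PiLp.add_apply, PiLp.smul_apply, PiLp.sub_apply, smul_eq_mul]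
      field_simp
      ring
    have hw12 : w₁ ≠ w₂ := by
      intro h
      have h1 : e₁ = e₂ := by rw [he₁, he₂, h]
      exact hray (h1 ▸ SameRay.refl _)
    have hfw₂ : f w₂ = f z := by
      have := congrArg f hk
      rw [map_smul, hfe, he₂, map_sub, smul_zero] at this
      linarith
    have hE := eventually_mem_of_openSegment hC h₁ h₂ (interior_subset hv) hw12 hz12 f hfw hfw₂
      (hf v hv)
    have hsmall : ∀ᶠ w in 𝓝 z, ‖w - z‖ < min ‖e₁‖ ‖e₂‖ := by
      have : Continuous fun w : Plane => ‖w - z‖ := by fun_prop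
      refine (this.tendsto z).eventually (gt_mem_nhds ?_)
      simp [he₁0, he₂0]
    filter_upwards [hE.eventually_nhds, hsmall] with w hw hws hwC hwi
    have hfw : f w = f z := by
      refine le_antisymm (hf' w hwC) ?_
      by_contra! hlt
      refine hwi (mem_interior_iff_mem_nhds.2 ?_)
      filter_upwards [hw, f.continuous.continuousAt.eventually (gt_mem_nhds hlt)] with a h1 h2
      exact h1 h2.le
    have hd0 : planeDet e₁ (w - z) = 0 := by
      by_contra h0
      have := map_eq_zero_of_planeDet_ne_zero h0 f hfe (by simp [hfw]) (v - z)
      rw [map_sub] at this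
      linarith [hf v hv]
    obtain ⟨m, hm⟩ := exists_smul_of_planeDet_eq_zero he₁0 hd0
    have hwm : w = z + m • (w₁ - z) := by rw [← he₁, ← hm]; abel
    rcases le_total 0 m with hm0 | hm0
    · refine .inl (hwm ▸ hseg w₁ m hm0 ?_)
      have := hws.trans_le (min_le_left _ _)
      rw [hm, norm_smul, Real.norm_eq_abs, abs_of_nonneg hm0] at this
      have h0 := norm_pos_iff.2 he₁0
      nlinarith
    · have hwm2 : w - z = (m / k) • e₂ := by
        rw [hk, smul_smul, div_mul_cancel₀ _ hkneg.ne, hm]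
      have hwm3 : w = z + (m / k) • (w₂ - z) := by rw [← he₂, ← hwm2]; abel
      have hmk : 0 ≤ m / k := div_nonneg_of_nonpos hm0 hkneg.le
      refine .inr (hwm3 ▸ hseg w₂ (m / k) hmk ?_)
      have := hws.trans_le (min_le_right _ _)
      rw [hwm2, norm_smul, Real.norm_eq_abs, abs_of_nonneg hmk] at this
      have h0 := norm_pos_iff.2 he₂0
      nlinarith
  -- independent directions: near `z` the set is the sector where both coordinates are nonnegative
  · set δ := planeDet e₁ e₂ with hδ
    have hcα : Continuous fun w => planeDet (w - z) e₂ / δ := by fun_prop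
    have hcβ : Continuous fun w => planeDet e₁ (w - z) / δ := by fun_prop
    have hα : Tendsto (fun w => planeDet (w - z) e₂ / δ) (𝓝 z) (𝓝 0) := by
      simpa [planeDet] using hcα.tendsto z
    have hβ : Tendsto (fun w => planeDet e₁ (w - z) / δ) (𝓝 z) (𝓝 0) := by
      simpa [planeDet] using hcβ.tendsto z
    have hsum := hα.add hβ
    rw [add_zero] at hsum
    have hfe₂ : f e₂ < 0 := by
      refine lt_of_le_of_ne (by simpa [he₂] using hf' w₂ h₂) fun h0 => ?_
      have := map_eq_zero_of_planeDet_ne_zero hdet f hfe h0 (v - z)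
      rw [map_sub] at this
      linarith [hf v hv]
    have hge₁ : g e₁ < 0 := by
      refine lt_of_le_of_ne (by simpa [he₁] using hg' w₁ h₁) fun h0 => ?_
      have := map_eq_zero_of_planeDet_ne_zero hdet g h0 hge (v - z)
      rw [map_sub] at this
      linarith [hg v hv]
    filter_upwards [hsum.eventually (gt_mem_nhds one_pos), hα.eventually (gt_mem_nhds one_pos),
      hβ.eventually (gt_mem_nhds one_pos)] with w hs hα1 hβ1 hwC hwi
    have hco := eq_coords hdet (w - z)
    rw [← hδ] at hco
    have hα0 : 0 ≤ planeDet (w - z) e₂ / δ := by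
      have h1 := congrArg g hco
      rw [map_add, map_smul, map_smul, hge, map_sub] at h1
      simp only [smul_eq_mul, mul_zero, add_zero] at h1
      have h2 := hg' w hwC
      by_contra! hneg
      nlinarith
    have hβ0 : 0 ≤ planeDet e₁ (w - z) / δ := by
      have h1 := congrArg f hco
      rw [map_add, map_smul, map_smul, hfe, map_sub] at h1
      simp only [smul_eq_mul, mul_zero, zero_add] at h1
      have h2 := hf' w hwC
      by_contra! hneg
      nlinarith
    rcases hα0.eq_or_lt with h0 | hα0
    · right
      rw [← h0, zero_smul, zero_add] at hco
      have : w = z + (planeDet e₁ (w - z) / δ) • (w₂ - z) := by rw [← he₂, ← hco]; abel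
      rw [this]
      exact hseg _ _ hβ0 hβ1.le
    rcases hβ0.eq_or_lt with h0 | hβ0
    · left
      rw [← h0, zero_smul, add_zero] at hco
      have : w = z + (planeDet (w - z) e₂ / δ) • (w₁ - z) := by rw [← he₁, ← hco]; abel
      rw [this]
      exact hseg _ _ hα0.le hα1.le
    refine absurd (mem_interior_iff_mem_nhds.2 ?_) hwi
    filter_upwards [hcα.continuousAt.eventually (lt_mem_nhds hα0),
      hcβ.continuousAt.eventually (lt_mem_nhds hβ0),
      (hcα.add hcβ).continuousAt.eventually (gt_mem_nhds hs)] with a h1 h2 h3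
    have hco := eq_coords hdet (a - z)
    rw [← hδ] at hco
    change planeDet (a - z) e₂ / δ + planeDet e₁ (a - z) / δ < 1 at h3
    set α := planeDet (a - z) e₂ / δ
    set β := planeDet e₁ (a - z) / δ
    have ha : a = (1 - α - β) • z + α • w₁ + β • w₂ := by
      have h4 : a = z + (a - z) := by abel
      rw [h4, hco, he₁, he₂]; module
    rw [ha]
    have := hC.sum_mem (t := Finset.univ) (w := ![1 - α - β, α, β])
      (z := ![z, w₁, w₂]) (by intro i _; fin_cases i <;> simp <;> linarith)
      (by simp [Fin.sum_univ_three]; ring) (by intro i _; fin_cases i <;> simp [hz, h₁, h₂])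
    simpa [Fin.sum_univ_three] using this

end PlaneGeometry

/-! ### Punctured and slit discs -/

section PuncturedDiscs

lemma isPreconnected_slitDisc (z : Plane) {e : Plane} (he : e ≠ 0) {r : ℝ} (hr : 0 < r) :
    IsPreconnected {w | w ∈ Metric.ball z r ∧ ∀ s : ℝ, 0 ≤ s → w ≠ z + s • e} := by
  have he' : 0 < ‖e‖ := norm_pos_iff.2 he
  set t : ℝ := r / (2 * ‖e‖) with ht
  have ht0 : 0 < t := by positivity
  -- the disc is star-shaped about a point on the ray opposite to the slit
  have hmem : z - t • e ∈ {w | w ∈ Metric.ball z r ∧ ∀ s : ℝ, 0 ≤ s → w ≠ z + s • e} := by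
    refine ⟨?_, fun s hs h => ?_⟩
    · rw [Metric.mem_ball, dist_eq_norm, sub_sub_cancel_left, norm_neg, norm_smul,
        Real.norm_of_nonneg ht0.le, ht]
      field_simp; norm_num
    · have h1 : (s + t) • e = 0 := by
        have : z + s • e - (z - t • e) = 0 := by rw [h, sub_self]
        rw [← this]; module
      rcases smul_eq_zero.1 h1 with h1 | h1
      · linarith
      · exact he h1
  have hstar : StarConvex ℝ (z - t • e)
      {w | w ∈ Metric.ball z r ∧ ∀ s : ℝ, 0 ≤ s → w ≠ z + s • e} := by
    intro w hw a b ha hb hab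
    refine ⟨convex_ball z r hmem.1 hw.1 ha hb hab, fun s hs h => ?_⟩
    obtain rfl : a = 1 - b := by linarith
    rcases hb.eq_or_lt with rfl | hb0
    · refine hmem.2 s hs ?_
      simpa using h
    · refine hw.2 ((s + (1 - b) * t) / b) (by positivity) ?_
      have h1 : b • w = b • z + (s + (1 - b) * t) • e := by
        have : b • w = (1 - b) • (z - t • e) + b • w - (1 - b) • (z - t • e) := by abel
        rw [this, h]; module
      have h2 : w = b⁻¹ • (b • w) := by rw [smul_smul, inv_mul_cancel₀ hb0.ne', one_smul]
      rw [h2, h1, smul_add, smul_smul, smul_smul, inv_mul_cancel₀ hb0.ne', one_smul,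
        inv_mul_eq_div]
  exact (hstar.isPathConnected hmem).isConnected.isPreconnected

lemma exists_mem_notMem_line {O : Set Plane} (hO : IsOpen O) (hne : O.Nonempty) (z : Plane)
    {e : Plane} (he : e ≠ 0) : ∃ w ∈ O, ∀ s : ℝ, w ≠ z + s • e := by
  have key : ∃ w ∈ O, planeDet e (w - z) ≠ 0 := by
    obtain ⟨w, hw⟩ := hne
    by_contra! hcon
    set d : Plane := !₂[-(e 1), e 0] with hd
    have hdet : 0 < planeDet e d := by
      have h0 : e 0 ≠ 0 ∨ e 1 ≠ 0 := by
        by_contra! h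
        exact he (by ext i; fin_cases i <;> simp [h.1, h.2])
      simp only [planeDet, hd, PiLp.toLp_apply, Matrix.cons_val_zero, Matrix.cons_val_one]
      rcases h0 with h | h <;> have := mul_self_pos.2 h <;>
        nlinarith [mul_self_nonneg (e 0), mul_self_nonneg (e 1)]
    obtain ⟨ε, h1, h2⟩ :=
      ((eventually_smul_add w d (hO.mem_nhds hw)).and self_mem_nhdsWithin).exists
    have h3 := hcon _ h1
    have h4 := hcon w hw
    have h5 : planeDet e (w + ε • d - z) = planeDet e (w - z) + ε * planeDet e d := by
      simp only [planeDet, PiLp.add_apply, PiLp.sub_apply, PiLp.smul_apply, smul_eq_mul]; ring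
    rw [h5, h4, zero_add] at h3
    have h2' : (0 : ℝ) < ε := h2
    have := mul_pos h2' hdet
    linarith
  obtain ⟨w, hw, h⟩ := key
  refine ⟨w, hw, fun s hs => h ?_⟩
  rw [hs, add_sub_cancel_left]
  simp only [planeDet, PiLp.smul_apply, smul_eq_mul]; ring

/-- A connected set that meets a closed set, and in which this closed set is open, is contained in
it. -/
lemma subset_of_forall_mem_nhds {S U : Set Plane} (hS : IsPreconnected S) (hU : IsClosed U)
    (h : ∀ w ∈ S, w ∈ U → U ∈ 𝓝 w) (hne : (S ∩ U).Nonempty) : S ⊆ U := by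
  refine (hS.subset_of_closure_inter_subset (isOpen_interior (s := U)) ?_ ?_).trans interior_subset
  · obtain ⟨w, hw, hw'⟩ := hne
    exact ⟨w, hw, mem_interior_iff_mem_nhds.2 (h w hw hw')⟩
  · rintro w ⟨hw, hwS⟩
    exact mem_interior_iff_mem_nhds.2 (h w hwS (closure_minimal interior_subset hU hw))

lemma exists_mem_slitDisc {U : Set Plane} {z e : Plane} (he : e ≠ 0) {r : ℝ} (hr : 0 < r)
    (hz : z ∈ closure (interior U)) :
    ∃ w ∈ U, w ∈ Metric.ball z r ∧ ∀ s : ℝ, 0 ≤ s → w ≠ z + s • e := by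
  obtain ⟨v, hv, hv'⟩ := mem_closure_iff.1 hz _ Metric.isOpen_ball (Metric.mem_ball_self hr)
  obtain ⟨w, ⟨hw, hw'⟩, h⟩ := exists_mem_notMem_line (isOpen_interior.inter Metric.isOpen_ball)
    ⟨v, hv', hv⟩ z he
  exact ⟨w, interior_subset hw, hw', fun s _ => h s⟩

/-- A closed set that is open in a punctured neighbourhood of a point of the closure of its
interior is a neighbourhood of this point. -/
lemma mem_nhds_of_punctured {U : Set Plane} {z : Plane} {r : ℝ} (hr : 0 < r) (hU : IsClosed U)
    (h : ∀ w ∈ Metric.ball z r, w ≠ z → w ∈ U → U ∈ 𝓝 w) (hz : z ∈ closure (interior U)) :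
    U ∈ 𝓝 z := by
  set e : Plane := !₂[1, 0] with hee
  have he : e ≠ 0 := fun h0 => by
    have := congrFun (congrArg WithLp.ofLp h0) 0
    simp [hee] at this
  obtain ⟨v, hvU, hv⟩ := exists_mem_slitDisc he hr hz
  have hsub := subset_of_forall_mem_nhds (isPreconnected_slitDisc z he hr) hU
    (fun w hw hwU => h w hw.1 (fun h0 => hw.2 0 le_rfl (by simp [h0])) hwU) ⟨v, hv, hvU⟩
  -- the slit has no interior points, so the closed set `U` contains it as well
  refine mem_of_superset (Metric.ball_mem_nhds z hr) fun w hw => ?_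
  by_contra hwU
  obtain ⟨w', ⟨h1, h2⟩, h3⟩ := exists_mem_notMem_line
    (Metric.isOpen_ball.inter hU.isOpen_compl) ⟨w, hw, hwU⟩ z he
  exact h2 (hsub ⟨h1, fun s _ => h3 s⟩)

lemma subset_or_subset_of_isClosed {S U V : Set Plane} (hS : IsPreconnected S) (hU : IsClosed U)
    (hV : IsClosed V) (hSUV : S ⊆ U ∪ V) (hd : ∀ w ∈ S, w ∈ U → w ∉ V) : S ⊆ U ∨ S ⊆ V := by
  by_contra! hcon
  obtain ⟨⟨w, hw, hwU⟩, ⟨w', hw', hwV⟩⟩ := And.imp not_subset.1 not_subset.1 hcon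
  obtain ⟨v, hv, hvU, hvV⟩ := isPreconnected_closed_iff.1 hS U V hU hV hSUV
    ⟨w', hw', (hSUV hw').resolve_right hwV⟩ ⟨w, hw, (hSUV hw).resolve_left hwU⟩
  exact hd v hv hvU hvV

/-- If two closed sets that meet only in `z` have, near `z`, boundary points only on two rays from
`z` contained in their union, then one of them is a neighbourhood of `z`: the union of two
different sectors has at least four boundary rays. -/
lemma mem_nhds_or_mem_nhds_of_two_rays {U V : Set Plane} {z e₁ e₂ : Plane} {r : ℝ} (hr : 0 < r)
    (he₁ : ‖e₁‖ = 1) (he₂ : ‖e₂‖ = 1) (hU : IsClosed U) (hV : IsClosed V)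
    (hzU : z ∈ closure (interior U)) (hzV : z ∈ closure (interior V)) (hUV : U ∩ V ⊆ {z})
    (hray₁ : ∀ s ∈ Ioo 0 r, z + s • e₁ ∈ U ∪ V) (hray₂ : ∀ s ∈ Ioo 0 r, z + s • e₂ ∈ U ∪ V)
    (hnU : ∀ w ∈ Metric.ball z r, (∀ s : ℝ, 0 ≤ s → w ≠ z + s • e₁) →
      (∀ s : ℝ, 0 ≤ s → w ≠ z + s • e₂) → w ∈ U → U ∈ 𝓝 w)
    (hnV : ∀ w ∈ Metric.ball z r, (∀ s : ℝ, 0 ≤ s → w ≠ z + s • e₁) →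
      (∀ s : ℝ, 0 ≤ s → w ≠ z + s • e₂) → w ∈ V → V ∈ 𝓝 w) : U ∈ 𝓝 z ∨ V ∈ 𝓝 z := by
  have hray : ∀ e : Plane, ‖e‖ = 1 → ∀ s : ℝ, 0 ≤ s → z + s • e ∈ Metric.ball z r →
      z + s • e ≠ z → s ∈ Ioo 0 r := by
    intro e he s hs hsr hne
    rw [Metric.mem_ball, dist_eq_norm, add_sub_cancel_left, norm_smul, he, mul_one,
      Real.norm_of_nonneg hs] at hsr
    refine ⟨lt_of_le_of_ne hs ?_, hsr⟩
    rintro rfl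
    simp at hne
  have hsplit : ∀ e : Plane, ‖e‖ = 1 → (∀ s ∈ Ioo 0 r, z + s • e ∈ U ∪ V) →
      (∀ s ∈ Ioo 0 r, z + s • e ∈ U) ∨ (∀ s ∈ Ioo 0 r, z + s • e ∈ V) := by
    intro e he h
    have hpre : IsPreconnected ((fun s : ℝ => z + s • e) '' Ioo 0 r) :=
      isPreconnected_Ioo.image _ (by fun_prop)
    have := subset_or_subset_of_isClosed hpre hU hV (by rintro _ ⟨s, hs, rfl⟩; exact h s hs) (by
      rintro _ ⟨s, hs, rfl⟩ h1 h2
      have h3 : z + s • e = z := hUV ⟨h1, h2⟩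
      rw [add_eq_left, smul_eq_zero] at h3
      rcases h3 with h3 | h3
      · exact hs.1.ne' h3
      · rw [h3, norm_zero] at he; exact zero_ne_one he)
    rw [image_subset_iff, image_subset_iff] at this
    exact this
  -- both rays in `V`: then `U` is open in a punctured disc
  have hsame : ∀ U V : Set Plane, IsClosed U → U ∩ V ⊆ {z} → z ∈ closure (interior U) →
      (∀ w ∈ Metric.ball z r, (∀ s : ℝ, 0 ≤ s → w ≠ z + s • e₁) →
        (∀ s : ℝ, 0 ≤ s → w ≠ z + s • e₂) → w ∈ U → U ∈ 𝓝 w) →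
      (∀ s ∈ Ioo 0 r, z + s • e₁ ∈ V) → (∀ s ∈ Ioo 0 r, z + s • e₂ ∈ V) → U ∈ 𝓝 z := by
    intro U V hU hUV hzU hn h1 h2
    refine mem_nhds_of_punctured hr hU (fun w hw hwz hwU => hn w hw ?_ ?_ hwU) hzU
    · rintro s hs rfl
      exact hwz (hUV ⟨hwU, h1 s (hray e₁ he₁ s hs hw hwz)⟩)
    · rintro s hs rfl
      exact hwz (hUV ⟨hwU, h2 s (hray e₂ he₂ s hs hw hwz)⟩)
  -- the second ray in `V`, the first one arbitrary: slit the disc along the first ray; then `U` is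
  -- open in the connected slit disc and fills it, so that nothing is left for `V`
  have hdiff : ∀ U V : Set Plane, IsClosed U → U ∩ V ⊆ {z} → z ∈ closure (interior U) →
      z ∈ closure (interior V) →
      (∀ w ∈ Metric.ball z r, (∀ s : ℝ, 0 ≤ s → w ≠ z + s • e₁) →
        (∀ s : ℝ, 0 ≤ s → w ≠ z + s • e₂) → w ∈ U → U ∈ 𝓝 w) →
      (∀ s ∈ Ioo 0 r, z + s • e₂ ∈ V) → False := by
    intro U V hU hUV hzU hzV hn h2
    have he0 : e₁ ≠ 0 := fun h0 => by rw [h0, norm_zero] at he₁; exact zero_ne_one he₁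
    obtain ⟨v, hvU, hv⟩ := exists_mem_slitDisc he0 hr hzU
    have hsub := subset_of_forall_mem_nhds (isPreconnected_slitDisc z he0 hr) hU
      (fun w hw hwU => hn w hw.1 hw.2 (by
        rintro s hs rfl
        have hwz : z + s • e₂ ≠ z := fun h0 => hw.2 0 le_rfl (by simp [h0])
        exact hwz (hUV ⟨hwU, h2 s (hray e₂ he₂ s hs hw.1 hwz)⟩)) hwU) ⟨v, hv, hvU⟩
    obtain ⟨w, hwV, hw⟩ := exists_mem_slitDisc he0 hr hzV
    have hwz : w = z := hUV ⟨hsub hw, hwV⟩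
    exact hw.2 0 le_rfl (by simp [hwz])
  have hVU : V ∩ U ⊆ {z} := by rwa [inter_comm]
  rcases hsplit e₁ he₁ hray₁ with h1 | h1 <;> rcases hsplit e₂ he₂ hray₂ with h2 | h2
  · exact .inr (hsame V U hV hVU hzV hnV h1 h2)
  · exact (hdiff U V hU hUV hzU hzV hnU h2).elim
  · exact (hdiff V U hV hVU hzV hzU hnV h2).elim
  · exact .inl (hsame U V hU hUV hzU hnU h1 h2)

end PuncturedDiscs

/-! ### The cells at a point -/

namespace FreeSpace

variable (X : FreeSpace)

lemma finite_vertexSet : X.vertexSet.Finite := finite_iUnion fun _ => finite_range _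

lemma isClosed_carrier : IsClosed X.carrier := X.isCompact_carrier.isClosed

lemma left_mem_edgeSet {n : ℕ} (P : Polygon Plane n) (i : Fin n) : P i ∈ P.edgeSet ℝ i :=
  left_mem_affineSegment ℝ _ _

lemma vertexSet_subset_frontier : X.vertexSet ⊆ frontier X.carrier := by
  intro z hz
  obtain ⟨k, i, rfl⟩ := by simpa [vertexSet] using hz
  rw [X.frontier_carrier]
  exact mem_iUnion.2 ⟨k, mem_iUnion.2 ⟨i, left_mem_edgeSet _ i⟩⟩

lemma isClosed_edgeSet {n : ℕ} (P : Polygon Plane n) (i : Fin n) : IsClosed (P.edgeSet ℝ i) := by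
  rw [Polygon.edgeSet, affineSegment_eq_segment, ← convexHull_pair]
  exact ((Set.finite_singleton _).insert _).isClosed_convexHull ℝ

lemma edgeSet_subset_carrier (k : Fin X.numLoops) (i : Fin (X.size k)) :
    (X.loop k).edgeSet ℝ i ⊆ X.carrier := by
  intro w hw
  have : w ∈ frontier X.carrier := by
    rw [X.frontier_carrier]; exact mem_iUnion.2 ⟨k, mem_iUnion.2 ⟨i, hw⟩⟩
  exact X.isClosed_carrier.frontier_subset this

/-- A segment from `z`, described by a unit vector: it is contained in the ray in this direction and
contains the beginning of this ray. -/
lemma exists_ray_of_segment {S : Set Plane} {z p : Plane} (hp : p ≠ z) (hS : segment ℝ z p ⊆ S) :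
    ∃ e : Plane, ∃ ρ : ℝ, ‖e‖ = 1 ∧ 0 < ρ ∧ (∀ s ∈ Ioo 0 ρ, z + s • e ∈ S) ∧
      ∀ w ∈ segment ℝ z p, ∃ s : ℝ, 0 ≤ s ∧ w = z + s • e := by
  have hn : 0 < ‖p - z‖ := norm_pos_iff.2 (sub_ne_zero.2 hp)
  refine ⟨‖p - z‖⁻¹ • (p - z), ‖p - z‖, ?_, hn, fun s hs => hS ?_, fun w hw => ?_⟩
  · rw [norm_smul, norm_inv, norm_norm, inv_mul_cancel₀ hn.ne']
  · rw [segment_eq_image']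
    refine ⟨s * ‖p - z‖⁻¹, ⟨mul_nonneg hs.1.le (inv_nonneg.2 hn.le), ?_⟩, by simp [smul_smul]⟩
    rw [← div_eq_mul_inv, div_le_one hn]
    exact hs.2.le
  · rw [segment_eq_image'] at hw
    obtain ⟨t, ht, rfl⟩ := hw
    exact ⟨t * ‖p - z‖, mul_nonneg ht.1 hn.le, by
      rw [smul_smul, mul_assoc, mul_inv_cancel₀ hn.ne', mul_one]⟩

/-- Near a vertex, the boundary of a free space consists of at most two segments that end there. -/
lemma exists_two_rays {z : Plane} (hz : z ∈ X.vertexSet) :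
    ∃ e₁ e₂ : Plane, ∃ ρ : ℝ, ‖e₁‖ = 1 ∧ ‖e₂‖ = 1 ∧ 0 < ρ ∧
      (∀ s ∈ Ioo 0 ρ, z + s • e₁ ∈ X.carrier) ∧ (∀ s ∈ Ioo 0 ρ, z + s • e₂ ∈ X.carrier) ∧
      ∀ᶠ w in 𝓝 z, w ∈ frontier X.carrier →
        (∃ s : ℝ, 0 ≤ s ∧ w = z + s • e₁) ∨ ∃ s : ℝ, 0 ≤ s ∧ w = z + s • e₂ := by
  obtain ⟨k, i, rfl⟩ := by simpa [vertexSet] using hz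
  obtain ⟨h3, hinj, hedge⟩ := X.loop_simple k
  set P := X.loop k with hP
  set j := (finRotate (X.size k)).symm i with hj
  have hji : finRotate (X.size k) j = i := Equiv.apply_symm_apply _ _
  have hrot : ∀ a : Fin (X.size k), finRotate (X.size k) a ≠ a := by
    intro a h
    obtain ⟨m, hm⟩ : ∃ m, X.size k = m + 2 := ⟨X.size k - 2, by omega⟩
    have : ∀ (n : ℕ) (a : Fin n), n = m + 2 → finRotate n a ≠ a := by
      rintro n a rfl h
      have h2 := support_finRotate (n := m)
      have : a ∈ (finRotate (m + 2)).support := by rw [h2]; exact Finset.mem_univ a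
      exact (Equiv.Perm.mem_support.1 this) h
    exact this _ a hm h
  obtain ⟨e₁, ρ₁, hn₁, hρ₁, hc₁, hs₁⟩ := exists_ray_of_segment (S := X.carrier)
    (z := P i) (p := P (finRotate _ i)) (fun h => hrot i (hinj h)) (by
      have := X.edgeSet_subset_carrier k i
      rwa [Polygon.edgeSet, affineSegment_eq_segment] at this)
  obtain ⟨e₂, ρ₂, hn₂, hρ₂, hc₂, hs₂⟩ := exists_ray_of_segment (S := X.carrier)
    (z := P i) (p := P j) (fun h => hrot j (by rw [hji]; exact (hinj h).symm)) (by
      have := X.edgeSet_subset_carrier k j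
      rwa [Polygon.edgeSet, affineSegment_eq_segment, hji, segment_symm] at this)
  refine ⟨e₁, e₂, min ρ₁ ρ₂, hn₁, hn₂, lt_min hρ₁ hρ₂,
    fun s hs => hc₁ s ⟨hs.1, hs.2.trans_le (min_le_left _ _)⟩,
    fun s hs => hc₂ s ⟨hs.1, hs.2.trans_le (min_le_right _ _)⟩, ?_⟩
  -- near the vertex only those edges matter that contain it
  have hev : ∀ᶠ w in 𝓝 (P i), ∀ k' : Fin X.numLoops, ∀ i' : Fin (X.size k'),
      w ∈ (X.loop k').edgeSet ℝ i' → P i ∈ (X.loop k').edgeSet ℝ i' := by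
    rw [eventually_all]
    intro k'
    rw [eventually_all]
    intro i'
    by_cases h : P i ∈ (X.loop k').edgeSet ℝ i'
    · exact Eventually.of_forall fun _ _ => h
    · filter_upwards [(isClosed_edgeSet _ i').isOpen_compl.mem_nhds h] with w hw hw'
      exact absurd hw' hw
  filter_upwards [hev] with w hw hwf
  rw [X.frontier_carrier] at hwf
  obtain ⟨k', hwf⟩ := mem_iUnion.1 hwf
  obtain ⟨i', hwf⟩ := mem_iUnion.1 hwf
  have hzi := hw k' i' hwf
  obtain rfl : k' = k := by
    by_contra hne
    refine (X.loop_disjoint k' k hne).le_bot ⟨mem_iUnion.2 ⟨i', hzi⟩, mem_iUnion.2 ⟨i, ?_⟩⟩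
    exact left_mem_edgeSet _ i
  by_cases hii : i' = i
  · subst hii
    refine .inl (hs₁ w ?_)
    rwa [Polygon.edgeSet, affineSegment_eq_segment] at hwf
  -- an edge through the vertex other than the one starting there is the preceding one
  · have hij : i' = j := by
      rcases hedge i i' (Ne.symm hii) (P i) ⟨left_mem_edgeSet _ i, hzi⟩ with ⟨-, h⟩ | ⟨h, -⟩
      · exact absurd (hinj h).symm hii
      · rw [hj, h, Equiv.symm_apply_apply]
    subst hij
    refine .inr (hs₂ w ?_)
    rwa [Polygon.edgeSet, affineSegment_eq_segment, hji, segment_symm] at hwf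

end FreeSpace

namespace ConvexDivision

variable {X : FreeSpace} {ι : Type*} (D : ConvexDivision X ι)

lemma convex_cell (c : ι) : Convex ℝ (D.cell c) := by
  obtain ⟨s, -, hs⟩ := D.cell_polygon c
  rw [hs]; exact convex_convexHull ℝ _

lemma isClosed_cell (c : ι) : IsClosed (D.cell c) := by
  obtain ⟨s, -, hs⟩ := D.cell_polygon c
  rw [hs]; exact s.finite_toSet.isClosed_convexHull ℝ

lemma cell_subset_carrier (c : ι) : D.cell c ⊆ X.carrier :=
  D.iUnion_cell ▸ subset_iUnion D.cell c

lemma exists_mem_cell {z : Plane} (hz : z ∈ X.carrier) : ∃ c, z ∈ D.cell c := by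
  rw [← D.iUnion_cell] at hz; exact mem_iUnion.1 hz

lemma mem_closure_interior_cell {c : ι} {z : Plane} (hz : z ∈ D.cell c) :
    z ∈ closure (interior (D.cell c)) := by
  rw [(D.convex_cell c).closure_interior_eq_closure_of_nonempty_interior
    (D.cell_interior_nonempty c)]
  exact subset_closure hz

lemma disjoint_interior_cell {c c' : ι} (h : c ≠ c') :
    Disjoint (interior (D.cell c)) (D.cell c') :=
  disjoint_interior_of_disjoint (D.convex_cell c') (D.cell_interior_nonempty c')
    (D.cell_disjoint c c' h)

/-- Points near `z` lie only in cells containing `z`. -/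
lemma eventually_star (z : Plane) : ∀ᶠ z' in 𝓝 z, ∀ c, z' ∈ D.cell c → z ∈ D.cell c := by
  have := D.finite_cells
  rw [eventually_all]
  intro c
  by_cases h : z ∈ D.cell c
  · exact Eventually.of_forall fun _ _ => h
  · filter_upwards [(D.isClosed_cell c).isOpen_compl.mem_nhds h] with w hw hw'
    exact absurd hw' hw

lemma exists_openSegment {c : ι} {w : Plane} (hw : w ∈ D.cell c) (hwv : w ∉ X.vertexSet) :
    ∃ p ∈ D.cell c, ∃ q ∈ D.cell c, p ≠ q ∧ w ∈ openSegment ℝ p q := by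
  obtain ⟨s, hsv, hs⟩ := D.cell_polygon c
  rw [hs] at hw ⊢
  exact exists_openSegment_of_notMem hw fun h => hwv (hsv h)

/-- Away from the vertices, two cells with a common point lie on the two sides of a cutline. -/
lemma union_mem_nhds {c c' : ι} {w : Plane} (hne : c ≠ c') (hw : w ∈ D.cell c)
    (hw' : w ∈ D.cell c') (hwv : w ∉ X.vertexSet) :
    D.cell c ∪ D.cell c' ∈ 𝓝 w ∧ D.graph.Adj c c' := by
  obtain ⟨p, hp, q, hq, hpq, h1⟩ := D.exists_openSegment hw hwv
  obtain ⟨p', hp', q', hq', hpq', h2⟩ := D.exists_openSegment hw' hwv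
  obtain ⟨h3, h4⟩ := union_mem_nhds_of_openSegment (D.convex_cell c) (D.convex_cell c')
    (D.cell_interior_nonempty c) (D.cell_interior_nonempty c') (D.cell_disjoint c c' hne) hw'
    hp hq hpq h1 hp' hq' hpq' h2
  exact ⟨h3, hne, h4⟩

/-- Away from the vertices, a point lies in at most two cells. -/
lemma eq_or_eq_of_mem {c c' c'' : ι} {w : Plane} (hne : c ≠ c') (hw : w ∈ D.cell c)
    (hw' : w ∈ D.cell c') (hw'' : w ∈ D.cell c'') (hwv : w ∉ X.vertexSet) :
    c'' = c ∨ c'' = c' := by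
  by_contra! hcon
  obtain ⟨h1, -⟩ := D.union_mem_nhds hne hw hw' hwv
  obtain ⟨v, hv, hv'⟩ := mem_closure_iff.1 (D.mem_closure_interior_cell hw'') _ isOpen_interior
    (mem_interior_iff_mem_nhds.2 h1)
  rcases interior_subset hv with h | h
  · exact (D.disjoint_interior_cell hcon.1).le_bot ⟨hv', h⟩
  · exact (D.disjoint_interior_cell hcon.2).le_bot ⟨hv', h⟩

lemma eventually_notMem_vertexSet (z : Plane) : ∀ᶠ w in 𝓝 z, w ≠ z → w ∉ X.vertexSet := by
  have h : (X.vertexSet \ {z})ᶜ ∈ 𝓝 z :=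
    (X.finite_vertexSet.subset sdiff_subset).isClosed.isOpen_compl.mem_nhds (by simp)
  filter_upwards [h] with w hw hne hwv
  exact hw ⟨hwv, hne⟩

lemma exists_ne_of_adj {c c' : ι} (h : D.graph.Adj c c') (z : Plane) :
    ∃ w ∈ D.cell c ∩ D.cell c', w ≠ z := h.2.exists_ne z

lemma segment_subset_cell {c : ι} {z w : Plane} (hz : z ∈ D.cell c) (hw : w ∈ D.cell c) :
    segment ℝ z w ⊆ D.cell c := (D.convex_cell c).segment_subset hz hw

/-- The cutlines from `z` to two different neighbours of a cell have different directions. -/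
lemma not_sameRay {c c' c'' : ι} (hne : c' ≠ c'') {z w₁ w₂ : Plane} (hcc' : c ≠ c')
    (hcc'' : c ≠ c'') (hz : z ∈ D.cell c) (hz' : z ∈ D.cell c') (hz'' : z ∈ D.cell c'')
    (h₁ : w₁ ∈ D.cell c ∩ D.cell c') (h₂ : w₂ ∈ D.cell c ∩ D.cell c'') (hw₁ : w₁ ≠ z)
    (hw₂ : w₂ ≠ z) : ¬ SameRay ℝ (w₁ - z) (w₂ - z) := by
  intro h
  obtain ⟨r₁, r₂, hr₁, hr₂, heq⟩ := h.exists_pos (sub_ne_zero.2 hw₁) (sub_ne_zero.2 hw₂)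
  obtain ⟨ε, h3, h4⟩ := ((eventually_smul_add z (r₁ • (w₁ - z))
    (eventually_notMem_vertexSet (X := X) z)).and
    (Ioo_mem_nhdsGT (lt_min (inv_pos.2 hr₁) (inv_pos.2 hr₂)))).exists
  have hε := h4.1
  have hmem : ∀ (d : ι) (w : Plane) (r : ℝ), z ∈ D.cell d → w ∈ D.cell d → 0 < r → ε < r⁻¹ →
      z + ε • (r • (w - z)) ∈ D.cell d := by
    intro d w r hzd hwd hr hε'
    rw [smul_smul]
    refine (D.convex_cell d).add_smul_sub_mem hzd hwd ⟨by positivity, ?_⟩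
    have := mul_le_mul_of_nonneg_right hε'.le hr.le
    rwa [inv_mul_cancel₀ hr.ne'] at this
  have hm1 := hmem c w₁ r₁ hz h₁.1 hr₁ (h4.2.trans_le (min_le_left _ _))
  have hm2 := hmem c' w₁ r₁ hz' h₁.2 hr₁ (h4.2.trans_le (min_le_left _ _))
  have hm3 := hmem c'' w₂ r₂ hz'' h₂.2 hr₂ (h4.2.trans_le (min_le_right _ _))
  rw [← heq] at hm3
  have hv := h3 (by
    rw [Ne, add_eq_left, smul_eq_zero, smul_eq_zero, not_or, not_or]
    exact ⟨hε.ne', hr₁.ne', sub_ne_zero.2 hw₁⟩)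
  rcases D.eq_or_eq_of_mem hcc' hm1 hm2 hm3 hv with h | h
  · exact hcc'' h.symm
  · exact hne h.symm

/-- A cell with two neighbours at `z` has, near `z`, no other boundary points than those on the
two cutlines. -/
lemma eventually_mem_neighbours {c c' c'' : ι} (hne : c' ≠ c'') {z : Plane} (hz : z ∈ D.cell c)
    (hz' : z ∈ D.cell c') (hz'' : z ∈ D.cell c'') (h₁ : D.graph.Adj c c')
    (h₂ : D.graph.Adj c c'') :
    ∀ᶠ w in 𝓝 z, w ∈ D.cell c → w ∉ interior (D.cell c) → w ∈ D.cell c' ∪ D.cell c'' := by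
  obtain ⟨w₁, hw₁, hw₁z⟩ := D.exists_ne_of_adj h₁ z
  obtain ⟨w₂, hw₂, hw₂z⟩ := D.exists_ne_of_adj h₂ z
  have hmid : ∀ (d : ι) (w : Plane), c ≠ d → z ∈ D.cell d → w ∈ D.cell d →
      midpoint ℝ z w ∉ interior (D.cell c) := fun d w hcd hzd hwd hm =>
    (D.disjoint_interior_cell hcd).le_bot ⟨hm, (D.convex_cell d).midpoint_mem hzd hwd⟩
  filter_upwards [eventually_mem_segment_of_notMem_interior (D.convex_cell c)
    (D.cell_interior_nonempty c) hz hw₁.1 hw₂.1 hw₁z hw₂z (hmid c' w₁ h₁.1 hz' hw₁.2)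
    (hmid c'' w₂ h₂.1 hz'' hw₂.2)
    (D.not_sameRay hne h₁.1 h₂.1 hz hz' hz'' hw₁ hw₂ hw₁z hw₂z)] with w hw h h'
  exact (hw h h').imp (fun h => D.segment_subset_cell hz' hw₁.2 h)
    (fun h => D.segment_subset_cell hz'' hw₂.2 h)

/-- The cells at a point form a forest: in each set of them, some cell has at most one neighbour.
Otherwise the cells of the set would close up to a full turn around the point, which then could
not be a vertex of the boundary. -/
lemma exists_leaf (z : Plane) (A : Set ι) (hA : A.Nonempty) (hz : ∀ c ∈ A, z ∈ D.cell c) :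
    ∃ c ∈ A, ∀ c' ∈ A, ∀ c'' ∈ A, D.graph.Adj c c' → D.graph.Adj c c'' → c' = c'' := by
  have := D.finite_cells
  by_cases hzv : z ∈ X.vertexSet
  · by_contra! hcon
    set U : Set Plane := ⋃ c ∈ A, D.cell c with hU
    have hUc : IsClosed U := A.toFinite.isClosed_biUnion fun c _ => D.isClosed_cell c
    have hUX : U ⊆ X.carrier := iUnion₂_subset fun c _ => D.cell_subset_carrier c
    have hsub : ∀ c ∈ A, D.cell c ⊆ U := fun c hc => subset_biUnion_of_mem (u := D.cell) hc
    have hev : ∀ᶠ w in 𝓝 z, ∀ c : ι, c ∈ A → w ≠ z → w ∈ D.cell c → U ∈ 𝓝 w := by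
      rw [eventually_all]
      intro c
      by_cases hc : c ∈ A
      · obtain ⟨c', hc', c'', hc'', h1, h2, hne⟩ := hcon c hc
        filter_upwards [D.eventually_mem_neighbours hne (hz c hc) (hz c' hc') (hz c'' hc'') h1 h2,
          eventually_notMem_vertexSet (X := X) z] with w hw hwv _ hwz hwc
        by_cases hwi : w ∈ interior (D.cell c)
        · exact mem_of_superset (mem_interior_iff_mem_nhds.1 hwi) (hsub c hc)
        · rcases hw hwc hwi with h | h
          · exact mem_of_superset (D.union_mem_nhds h1.1 hwc h (hwv hwz)).1
              (union_subset (hsub c hc) (hsub c' hc'))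
          · exact mem_of_superset (D.union_mem_nhds h2.1 hwc h (hwv hwz)).1
              (union_subset (hsub c hc) (hsub c'' hc''))
      · exact Eventually.of_forall fun _ h => absurd h hc
    obtain ⟨r, hr, hball⟩ := Metric.eventually_nhds_iff_ball.1 hev
    obtain ⟨c, hc⟩ := hA
    have hmem := mem_nhds_of_punctured hr hUc (fun w hw hwz hwU => by
      obtain ⟨d, hd, hwd⟩ := mem_iUnion₂.1 hwU
      exact hball w hw d hd hwz hwd)
      (closure_mono (interior_mono (hsub c hc)) (D.mem_closure_interior_cell (hz c hc)))
    exact (X.vertexSet_subset_frontier hzv).2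
      (mem_interior_iff_mem_nhds.2 (mem_of_superset hmem hUX))
  · obtain ⟨c, hc⟩ := hA
    refine ⟨c, hc, fun c' hc' c'' hc'' h1 h2 => ?_⟩
    rcases D.eq_or_eq_of_mem h1.1 (hz c hc) (hz c' hc') (hz c'' hc'') hzv with h | h
    · exact absurd h.symm h2.1
    · exact h.symm

/-- Every labelling of a forest is the difference of a potential. -/
lemma exists_potential {F : Type*} [Group F] {e : ι → ι → F} (hinv : ∀ x y, e x y * e y x = 1)
    (z : Plane) : ∃ φ : ι → F, ∀ c c', D.graph.Adj c c' → z ∈ D.cell c → z ∈ D.cell c' →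
      e c c' = (φ c)⁻¹ * φ c' := by
  classical
  have := D.finite_cells
  suffices H : ∀ (n : ℕ) (A : Finset ι), A.card = n → (∀ c ∈ A, z ∈ D.cell c) →
      ∃ φ : ι → F, ∀ c ∈ A, ∀ c' ∈ A, D.graph.Adj c c' → e c c' = (φ c)⁻¹ * φ c' by
    have := Fintype.ofFinite ι
    obtain ⟨φ, hφ⟩ := H _ (Finset.univ.filter fun c => z ∈ D.cell c) rfl (by simp)
    exact ⟨φ, fun c c' h hc hc' => hφ c (by simpa using hc) c' (by simpa using hc') h⟩
  have hswap : ∀ x y, e x y = (e y x)⁻¹ := fun x y => eq_inv_of_mul_eq_one_left (hinv x y)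
  intro n
  induction n with
  | zero =>
    intro A hA _
    rw [Finset.card_eq_zero] at hA
    exact ⟨fun _ => 1, by simp [hA]⟩
  | succ n ih =>
    intro A hA hz
    have hne : A.Nonempty := by rw [← Finset.card_pos]; omega
    obtain ⟨c, hc, hleaf⟩ := D.exists_leaf z (A : Set ι) hne (by simpa using hz)
    simp only [Finset.mem_coe] at hc hleaf
    obtain ⟨φ, hφ⟩ := ih (A.erase c) (by rw [Finset.card_erase_of_mem hc]; omega)
      fun d hd => hz d (Finset.mem_of_mem_erase hd)
    -- the potential at the leaf is dictated by its only neighbour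
    obtain ⟨g, hg⟩ : ∃ g : F, ∀ c' ∈ A, D.graph.Adj c c' → e c c' = g⁻¹ * φ c' := by
      by_cases h : ∃ c₀ ∈ A, D.graph.Adj c c₀
      · obtain ⟨c₀, hc₀, hadj⟩ := h
        refine ⟨φ c₀ * e c₀ c, fun c' hc' h' => ?_⟩
        rw [hleaf c' hc' c₀ hc₀ h' hadj, hswap c c₀]
        group
      · push Not at h
        exact ⟨1, fun c' hc' h' => absurd h' (h c' hc')⟩
    refine ⟨Function.update φ c g, fun d hd d' hd' hadj => ?_⟩
    by_cases h1 : d = c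
    · subst h1
      rw [Function.update_self, Function.update_of_ne hadj.1.symm, hg d' hd' hadj]
    by_cases h2 : d' = c
    · subst h2
      rw [Function.update_self, Function.update_of_ne h1, hswap, hg d hd hadj.symm]
      group
    · rw [Function.update_of_ne h1, Function.update_of_ne h2]
      exact hφ d (Finset.mem_erase.2 ⟨h1, hd⟩) d' (Finset.mem_erase.2 ⟨h2, hd'⟩) hadj

/-- The cells at a point are connected through cutlines at this point: two unconnected families
would be two sectors with at least four boundary rays. -/
lemma reflTransGen_star {z : Plane} {c c' : ι} (hc : z ∈ D.cell c) (hc' : z ∈ D.cell c') :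
    Relation.ReflTransGen (fun d d' => D.graph.Adj d d' ∧ z ∈ D.cell d ∧ z ∈ D.cell d') c c' := by
  have := D.finite_cells
  set R := Relation.ReflTransGen
    (fun d d' => D.graph.Adj d d' ∧ z ∈ D.cell d ∧ z ∈ D.cell d') with hR
  by_cases hzv : z ∈ X.vertexSet
  · by_contra hcon
    -- the cells that are connected to `c` at `z`, and the others
    set U : Set Plane := ⋃ d ∈ {d | z ∈ D.cell d ∧ R c d}, D.cell d with hU
    set V : Set Plane := ⋃ d ∈ {d | z ∈ D.cell d ∧ ¬ R c d}, D.cell d with hV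
    have hUc : IsClosed U := (toFinite _).isClosed_biUnion fun c _ => D.isClosed_cell c
    have hVc : IsClosed V := (toFinite _).isClosed_biUnion fun c _ => D.isClosed_cell c
    have hUX : U ⊆ X.carrier := iUnion₂_subset fun c _ => D.cell_subset_carrier c
    have hVX : V ⊆ X.carrier := iUnion₂_subset fun c _ => D.cell_subset_carrier c
    have hUV : U ∩ V ⊆ {z} := by
      rintro w ⟨hwU, hwV⟩
      obtain ⟨d, ⟨hd, hcd⟩, hwd⟩ := mem_iUnion₂.1 hwU
      obtain ⟨d', ⟨hd', hcd'⟩, hwd'⟩ := mem_iUnion₂.1 hwV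
      by_contra hwz
      refine hcd' (hcd.tail ⟨⟨?_, w, ⟨hwd, hwd'⟩, z, ⟨hd, hd'⟩, hwz⟩, hd, hd'⟩)
      rintro rfl
      exact hcd' hcd
    have hzU : z ∈ closure (interior U) := closure_mono (interior_mono
      (subset_biUnion_of_mem (u := D.cell) (show c ∈ {d | z ∈ D.cell d ∧ R c d} from ⟨hc, .refl⟩)))
      (D.mem_closure_interior_cell hc)
    have hzV : z ∈ closure (interior V) := closure_mono (interior_mono
      (subset_biUnion_of_mem (u := D.cell)
        (show c' ∈ {d | z ∈ D.cell d ∧ ¬ R c d} from ⟨hc', hcon⟩)))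
      (D.mem_closure_interior_cell hc')
    obtain ⟨e₁, e₂, ρ, hn₁, hn₂, hρ, hs₁, hs₂, hfr⟩ := X.exists_two_rays hzv
    have hcover : ∀ᶠ w in 𝓝 z, w ∈ X.carrier → w ∈ U ∪ V := by
      filter_upwards [D.eventually_star z] with w hw hwX
      obtain ⟨d, hd⟩ := D.exists_mem_cell hwX
      by_cases hcd : R c d
      · exact .inl (mem_iUnion₂.2 ⟨d, ⟨hw d hd, hcd⟩, hd⟩)
      · exact .inr (mem_iUnion₂.2 ⟨d, ⟨hw d hd, hcd⟩, hd⟩)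
    obtain ⟨r', hr', hball⟩ := Metric.eventually_nhds_iff_ball.1
      (hfr.and (hcover.and hcover.eventually_nhds))
    set r := min r' ρ with hr
    have hr0 : 0 < r := lt_min hr' hρ
    have hball' : Metric.ball z r ⊆ Metric.ball z r' := Metric.ball_subset_ball (min_le_left _ _)
    have hray : ∀ e : Plane, ‖e‖ = 1 → (∀ s ∈ Ioo 0 ρ, z + s • e ∈ X.carrier) →
        ∀ s ∈ Ioo 0 r, z + s • e ∈ U ∪ V := by
      intro e he h s hs
      refine (hball _ (hball' ?_)).2.1 (h s ⟨hs.1, hs.2.trans_le (min_le_right _ _)⟩)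
      rw [Metric.mem_ball, dist_eq_norm, add_sub_cancel_left, norm_smul, he, mul_one,
        Real.norm_of_nonneg hs.1.le]
      exact hs.2
    have hn : ∀ A B : Set Plane, A ∪ B = U ∪ V → A ⊆ X.carrier → IsClosed B → A ∩ B ⊆ {z} →
        ∀ w ∈ Metric.ball z r, (∀ s : ℝ, 0 ≤ s → w ≠ z + s • e₁) →
        (∀ s : ℝ, 0 ≤ s → w ≠ z + s • e₂) → w ∈ A → A ∈ 𝓝 w := by
      intro A B hAB hAX hB hABz w hw h1 h2 hwA
      obtain ⟨hf, -, hco⟩ := hball w (hball' hw)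
      have hwB : w ∉ B := fun hwB => h1 0 le_rfl (by simpa using hABz ⟨hwA, hwB⟩)
      have hwX : X.carrier ∈ 𝓝 w := by
        rw [← mem_interior_iff_mem_nhds]
        by_contra hwi
        have hwf : w ∈ frontier X.carrier := ⟨subset_closure (hAX hwA), hwi⟩
        rcases hf hwf with ⟨s, hs, h⟩ | ⟨s, hs, h⟩
        · exact h1 s hs h
        · exact h2 s hs h
      filter_upwards [hwX, hco, hB.isOpen_compl.mem_nhds hwB] with v hvX hv hvB
      exact ((hAB ▸ hv hvX : v ∈ A ∪ B)).resolve_right hvB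
    have hfin : X.carrier ∈ 𝓝 z := by
      rcases mem_nhds_or_mem_nhds_of_two_rays hr0 hn₁ hn₂ hUc hVc hzU hzV hUV (hray e₁ hn₁ hs₁)
        (hray e₂ hn₂ hs₂) (hn U V rfl hUX hVc hUV)
        (hn V U (union_comm _ _) hVX hUc (by rwa [inter_comm])) with h | h
      · exact mem_of_superset h hUX
      · exact mem_of_superset h hVX
    exact (X.vertexSet_subset_frontier hzv).2 (mem_interior_iff_mem_nhds.2 hfin)
  · by_cases h : c = c'
    · rw [h]
    · exact .single ⟨(D.union_mem_nhds h hc hc' hzv).2, hc, hc'⟩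

end ConvexDivision

/-! ### Lengths and shortest paths -/

section PathLength

variable {X : FreeSpace} {x y w : X.carrier}

lemma edist_le_eVariationOn (p : Path x y) {u v : I} (huv : u ≤ v) :
    edist (p u : Plane) (p v) ≤ eVariationOn (fun t : I => (p t : Plane)) (Icc u v) :=
  eVariationOn.edist_le _ (left_mem_Icc.2 huv) (right_mem_Icc.2 huv)

lemma eVariationOn_Icc_add_Icc (f : I → Plane) {a b c : I} (hab : a ≤ b) (hbc : b ≤ c) :
    eVariationOn f (Icc a b) + eVariationOn f (Icc b c) = eVariationOn f (Icc a c) := by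
  simpa using eVariationOn.Icc_add_Icc f (s := univ) hab hbc (mem_univ b)

lemma pathLength_eq_Icc (p : Path x y) :
    pathLength p = eVariationOn (fun t : I => (p t : Plane)) (Icc 0 1) := by
  rw [pathLength]
  congr
  ext t
  exact ⟨fun _ => ⟨t.2.1, t.2.2⟩, fun _ => mem_univ t⟩

lemma pathLength_trans_le (p : Path x y) (q : Path y w) :
    pathLength (p.trans q) ≤ pathLength p + pathLength q := by
  set h : I := ⟨1 / 2, by norm_num, by norm_num⟩ with hh
  rw [pathLength_eq_Icc, ← eVariationOn_Icc_add_Icc _ (a := 0) (b := h) (c := 1) h.2.1 h.2.2]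
  refine add_le_add ?_ ?_
  · have : EqOn (fun t : I => (p.trans q t : Plane)) ((fun t : I => (p t : Plane)) ∘
        fun t : I => projIcc 0 1 zero_le_one (2 * (t : ℝ))) (Icc 0 h) := by
      intro t ht
      have h1 : (t : ℝ) ≤ 1 / 2 := ht.2
      simp only [Path.trans, Path.coe_mk', ContinuousMap.coe_mk, Function.comp_apply, h1, if_true]
      rfl
    rw [eVariationOn.congr this]
    exact eVariationOn.comp_le_of_monotoneOn _ _
      (fun a _ b _ hab => monotone_projIcc _ (by
        have : (a : ℝ) ≤ b := hab
        linarith)) (mapsTo_univ _ _)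
  · have : EqOn (fun t : I => (p.trans q t : Plane)) ((fun t : I => (q t : Plane)) ∘
        fun t : I => projIcc 0 1 zero_le_one (2 * (t : ℝ) - 1)) (Icc h 1) := by
      intro t ht
      have h1 : 1 / 2 ≤ (t : ℝ) := ht.1
      simp only [Path.trans, Path.coe_mk', ContinuousMap.coe_mk, Function.comp_apply]
      split_ifs with h2
      · have h3 : (t : ℝ) = 1 / 2 := le_antisymm h2 h1
        rw [h3]
        simp
      · rfl
    rw [eVariationOn.congr this]
    exact eVariationOn.comp_le_of_monotoneOn _ _
      (fun a _ b _ hab => monotone_projIcc _ (by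
        have : (a : ℝ) ≤ b := hab
        linarith)) (mapsTo_univ _ _)

lemma pathLength_subpath_le (p : Path x y) {u v : I} (huv : u ≤ v) :
    pathLength (p.subpath u v) ≤ eVariationOn (fun t : I => (p t : Plane)) (Icc u v) := by
  refine eVariationOn.comp_le_of_monotoneOn (fun t : I => (p t : Plane)) (Icc.convexComb u v)
    (fun a _ b _ hab => ?_) (fun a _ => ?_)
  · have h1 : (u : ℝ) ≤ v := huv
    have h2 : (a : ℝ) ≤ b := hab
    change (1 - (a : ℝ)) * u + a * v ≤ (1 - (b : ℝ)) * u + b * v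
    nlinarith
  · have := Path.range_subpathAux u v ▸ mem_range_self a
    rwa [uIcc_of_le huv] at this

/-- The straight path between two points joined by a segment in the free space. -/
noncomputable def segmentPath (x y : X.carrier) (h : segment ℝ (x : Plane) y ⊆ X.carrier) :
    Path x y where
  toFun t := ⟨AffineMap.lineMap (x : Plane) y (t : ℝ), h (by
    rw [segment_eq_image_lineMap]; exact ⟨t, t.2, rfl⟩)⟩
  continuous_toFun := by
    refine Continuous.subtype_mk ?_ _
    exact AffineMap.lineMap_continuous.comp continuous_subtype_val
  source' := by simp
  target' := by simp

lemma segmentPath_mem (h : segment ℝ (x : Plane) y ⊆ X.carrier) (t : I) :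
    (segmentPath x y h t : Plane) ∈ segment ℝ (x : Plane) y := by
  rw [segment_eq_image_lineMap]; exact ⟨t, t.2, rfl⟩

lemma pathLength_segmentPath_le (h : segment ℝ (x : Plane) y ⊆ X.carrier) :
    pathLength (segmentPath x y h) ≤ edist (x : Plane) y := by
  have h1 : LipschitzOnWith (nndist (x : Plane) y)
      (AffineMap.lineMap (x : Plane) (y : Plane) : ℝ → Plane) univ :=
    (lipschitzWith_lineMap _ _).lipschitzOnWith
  have h2 := h1.comp_eVariationOn_le (g := fun t : I => (t : ℝ)) (s := univ) (mapsTo_univ _ _)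
  refine h2.trans ?_
  have h3 := MonotoneOn.eVariationOn_eq (f := fun t : I => (t : ℝ)) (s := univ)
    (fun _ _ _ _ hab => hab) (mem_univ 0) (mem_univ 1)
  have h4 : (univ : Set I) ∩ Icc 0 1 = univ := 
    eq_univ_of_forall fun t => ⟨mem_univ t, t.2.1, t.2.2⟩
  rw [h4] at h3
  simp only [Icc.coe_one, Icc.coe_zero, sub_zero, ENNReal.ofReal_one] at h3
  rw [edist_nndist]
  exact (mul_le_mul_right h3.le _).trans (by rw [mul_one])

/-- Within a star-shaped part of the free space, paths with the same endpoints are homotopic. -/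
lemma homotopic_of_starConvex {S : Set Plane} {z : Plane} (hS : StarConvex ℝ z S)
    (hSX : S ⊆ X.carrier) (p q : Path x y) (hp : ∀ t, (p t : Plane) ∈ S)
    (hq : ∀ t, (q t : Plane) ∈ S) : p.Homotopic q := by
  have hx : (x : Plane) ∈ S := by simpa using hp 0
  have hy : (y : Plane) ∈ S := by simpa using hp 1
  have := hS.contractibleSpace ⟨_, hx⟩
  let p' : Path (⟨x, hx⟩ : S) ⟨y, hy⟩ :=
    { toFun := fun t => ⟨p t, hp t⟩
      continuous_toFun := by fun_prop
      source' := by simp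
      target' := by simp }
  let q' : Path (⟨x, hx⟩ : S) ⟨y, hy⟩ :=
    { toFun := fun t => ⟨q t, hq t⟩
      continuous_toFun := by fun_prop
      source' := by simp
      target' := by simp }
  exact (SimplyConnectedSpace.paths_homotopic p' q').map ⟨inclusion hSX, continuous_inclusion hSX⟩

lemma homotopic_cast_of_cast {Y : Type*} [TopologicalSpace Y] {x y x' y' : Y} (hx : x' = x)
    (hy : y' = y) {p : Path x y} {q : Path x' y'} (h : (p.cast hx hy).Homotopic q) :
    p.Homotopic (q.cast hx.symm hy.symm) := by
  subst hx hy; exact h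

lemma pathLength_cast {x' y' : X.carrier} (hx : x' = x) (hy : y' = y) (p : Path x y) :
    pathLength (p.cast hx hy) = pathLength p := rfl

/-- Every point has star-shaped neighbourhoods in the free space, whose points lie in cells
containing this point. -/
lemma ConvexDivision.exists_starConvex {ι : Type*} (D : ConvexDivision X ι) (z : Plane) :
    ∃ r > 0, StarConvex ℝ z (X.carrier ∩ Metric.ball z r) ∧
      ∀ w ∈ Metric.ball z r, ∀ c, w ∈ D.cell c → z ∈ D.cell c := by
  obtain ⟨r, hr, hball⟩ := Metric.eventually_nhds_iff_ball.1 (D.eventually_star z)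
  refine ⟨r, hr, fun w hw a b ha hb hab => ⟨?_, ?_⟩, hball⟩
  · obtain ⟨c, hc⟩ := D.exists_mem_cell hw.1
    exact D.cell_subset_carrier c (D.convex_cell c (hball w hw.2 c hc) hc ha hb hab)
  · exact convex_ball z r (Metric.mem_ball_self hr) hw.2 ha hb hab

/-- Every path in the free space is homotopic to a path of finite length: it can be replaced by a
polygonal path through the centres of star-shaped neighbourhoods. -/
lemma ConvexDivision.exists_homotopic_pathLength_ne_top {ι : Type*} (D : ConvexDivision X ι)
    (p : Path x y) : ∃ q : Path x y, p.Homotopic q ∧ pathLength q ≠ ⊤ := by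
  choose r hr hstar _ using fun t : I => D.exists_starConvex (p t : Plane)
  obtain ⟨t, ht0, htm, ⟨N, hN⟩, ht⟩ := exists_monotone_Icc_subset_open_cover_unitInterval
    (c := fun s : I => {u : I | (p u : Plane) ∈ Metric.ball (p s : Plane) (r s)})
    (fun s => Metric.isOpen_ball.preimage (by fun_prop))
    (fun s _ => mem_iUnion.2 ⟨s, Metric.mem_ball_self (hr s)⟩)
  have hpiece : ∀ n, ∃ q : Path (p (t n)) (p (t (n + 1))),
      (p.subpath (t n) (t (n + 1))).Homotopic q ∧ pathLength q ≠ ⊤ := by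
    intro n
    obtain ⟨s, hs⟩ := ht n
    have hle := htm n.le_succ
    set S := X.carrier ∩ Metric.ball (p s : Plane) (r s) with hS
    have h1 : (p (t n) : Plane) ∈ S := ⟨(p _).2, hs (left_mem_Icc.2 hle)⟩
    have h2 : (p (t (n + 1)) : Plane) ∈ S := ⟨(p _).2, hs (right_mem_Icc.2 hle)⟩
    have hs1 : segment ℝ (p (t n) : Plane) (p s) ⊆ S := by
      rw [segment_symm]; exact (hstar s).segment_subset h1
    have hs2 : segment ℝ (p s : Plane) (p (t (n + 1))) ⊆ S := (hstar s).segment_subset h2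
    refine ⟨(segmentPath (p (t n)) (p s) (hs1.trans inter_subset_left)).trans
      (segmentPath (p s) (p (t (n + 1))) (hs2.trans inter_subset_left)),
      homotopic_of_starConvex (hstar s) inter_subset_left _ _ ?_ ?_, ?_⟩
    · intro u
      have : p.subpath (t n) (t (n + 1)) u ∈ p '' Icc (t n) (t (n + 1)) := by
        rw [← Path.range_subpath_of_le _ _ _ hle]; exact mem_range_self u
      obtain ⟨v, hv, hvu⟩ := this
      rw [← hvu]
      exact ⟨(p v).2, hs hv⟩
    · intro u
      have := mem_range_self (f := (segmentPath (p (t n)) (p s) (hs1.trans inter_subset_left)).trans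
        (segmentPath (p s) (p (t (n + 1))) (hs2.trans inter_subset_left))) u
      rw [Path.trans_range] at this
      rcases this with ⟨v, hv⟩ | ⟨v, hv⟩
      · rw [← hv]; exact hs1 (segmentPath_mem _ v)
      · rw [← hv]; exact hs2 (segmentPath_mem _ v)
    · refine ne_top_of_le_ne_top ?_ ((pathLength_trans_le _ _).trans
        (add_le_add (pathLength_segmentPath_le _) (pathLength_segmentPath_le _)))
      exact ENNReal.add_ne_top.2 ⟨edist_ne_top _ _, edist_ne_top _ _⟩
  have hall : ∀ n, ∃ q : Path (p 0) (p (t n)),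
      (p.subpath 0 (t n)).Homotopic q ∧ pathLength q ≠ ⊤ := by
    intro n
    induction n with
    | zero =>
      rw [ht0]
      refine ⟨Path.refl _, by rw [Path.subpath_self], ?_⟩
      have : pathLength (Path.refl (p 0)) = 0 :=
        eVariationOn.constant_on (by rintro _ ⟨a, -, rfl⟩ _ ⟨b, -, rfl⟩; rfl)
      simp [this]
    | succ n ih =>
      obtain ⟨q, hq, hqt⟩ := ih
      obtain ⟨q', hq', hqt'⟩ := hpiece n
      exact ⟨q.trans q', (Path.Homotopic.symm ⟨Path.Homotopy.subpathTransSubpath p _ _ _⟩).trans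
        (hq.hcomp hq'), ne_top_of_le_ne_top (ENNReal.add_ne_top.2 ⟨hqt, hqt'⟩)
        (pathLength_trans_le _ _)⟩
  have hlast := hall N
  rw [hN N le_rfl] at hlast
  obtain ⟨q, hq, hqt⟩ := hlast
  rw [Path.subpath_zero_one] at hq
  exact ⟨_, homotopic_cast_of_cast _ _ hq, by rwa [pathLength_cast]⟩

/-- A shortest path in its homotopy class that runs within a star-shaped set between two times is
straight between these times, provided the segment lies in the set. -/
lemma IsLocallyOptimal.mem_segment {ι : Type*} (D : ConvexDivision X ι) {g f : Path x y}
    (hg : IsLocallyOptimal g f) {S : Set Plane} {z : Plane} (hS : StarConvex ℝ z S)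
    (hSX : S ⊆ X.carrier) {u v : I} (huv : u ≤ v) (hgS : ∀ s ∈ Icc u v, (g s : Plane) ∈ S)
    (hseg : segment ℝ (g u : Plane) (g v) ⊆ S) :
    ∀ s ∈ Icc u v, (g s : Plane) ∈ segment ℝ (g u : Plane) (g v) := by
  have hfin : pathLength g ≠ ⊤ := by
    obtain ⟨q, hq, hqt⟩ := D.exists_homotopic_pathLength_ne_top f
    exact ne_top_of_le_ne_top hqt (hg.2 q hq.symm)
  -- compare with the path that takes the segment as a shortcut
  set τ := segmentPath (g u) (g v) (hseg.trans hSX) with hτ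
  have hτh : (g.subpath u v).Homotopic τ := by
    refine homotopic_of_starConvex hS hSX _ _ ?_ fun t => hseg (segmentPath_mem _ t)
    intro t
    have : g.subpath u v t ∈ g '' Icc u v := by
      rw [← Path.range_subpath_of_le _ _ _ huv]; exact mem_range_self t
    obtain ⟨s, hs, hst⟩ := this
    rw [← hst]
    exact hgS s hs
  set h := ((g.subpath 0 u).trans τ).trans (g.subpath v 1) with hh
  have h1 : (g.subpath 0 1).Homotopic h := by
    have a1 : ((g.subpath 0 u).trans (g.subpath u v)).Homotopic (g.subpath 0 v) :=
      ⟨Path.Homotopy.subpathTransSubpath g _ _ _⟩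
    have a2 : ((g.subpath 0 v).trans (g.subpath v 1)).Homotopic (g.subpath 0 1) :=
      ⟨Path.Homotopy.subpathTransSubpath g _ _ _⟩
    refine a2.symm.trans (Path.Homotopic.hcomp (a1.symm.trans ?_) (.refl _))
    exact Path.Homotopic.hcomp (.refl _) hτh
  rw [Path.subpath_zero_one] at h1
  have h2 := hg.2 _ ((homotopic_cast_of_cast _ _ h1).symm.trans hg.1)
  rw [pathLength_cast] at h2
  have h3 : pathLength h ≤ eVariationOn (fun t : I => (g t : Plane)) (Icc 0 u) +
      edist (g u : Plane) (g v) + eVariationOn (fun t : I => (g t : Plane)) (Icc v 1) :=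
    (pathLength_trans_le _ _).trans (add_le_add ((pathLength_trans_le _ _).trans
      (add_le_add (pathLength_subpath_le _ u.2.1) (pathLength_segmentPath_le _)))
      (pathLength_subpath_le _ v.2.2))
  have h4 := h2.trans h3
  rw [pathLength_eq_Icc] at h4 hfin
  rw [← eVariationOn_Icc_add_Icc _ (v.2.1 : (0 : I) ≤ v) (v.2.2 : v ≤ (1 : I)),
    ← eVariationOn_Icc_add_Icc _ (u.2.1 : (0 : I) ≤ u) huv] at h4 hfin
  rw [ENNReal.add_ne_top, ENNReal.add_ne_top] at hfin
  have h5 : eVariationOn (fun t : I => (g t : Plane)) (Icc u v) ≤ edist (g u : Plane) (g v) :=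
    (ENNReal.add_le_add_iff_left hfin.1.1).1 ((ENNReal.add_le_add_iff_right hfin.2).1 h4)
  intro s hs
  have h6 : edist (g u : Plane) (g s) + edist (g s : Plane) (g v) ≤ edist (g u : Plane) (g v) := by
    refine le_trans ?_ h5
    rw [← eVariationOn_Icc_add_Icc _ hs.1 hs.2]
    exact add_le_add (edist_le_eVariationOn g hs.1) (edist_le_eVariationOn g hs.2)
  rw [edist_dist, edist_dist, edist_dist, ← ENNReal.ofReal_add dist_nonneg dist_nonneg,
    ENNReal.ofReal_le_ofReal_iff dist_nonneg] at h6
  rw [mem_segment_iff_wbtw]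
  exact dist_add_dist_eq_iff.1 (le_antisymm h6 (dist_triangle _ _ _))

end PathLength

/-! ### Cell sequences of paths -/

section Visits

variable {E ι : Type*} {cell : ι → Set E} {p : I → E}

lemma Visits.le : ∀ {l : List ι} {s e : I}, Visits cell p l s e → s ≤ e
  | [], _, _, h => le_of_eq h
  | _ :: _, _, _, ⟨_, h, _, h'⟩ => h.trans h'.le

lemma visits_append {l l' : List ι} {s e : I} :
    Visits cell p (l ++ l') s e ↔ ∃ m, Visits cell p l s m ∧ Visits cell p l' m e := by
  induction l generalizing s with
  | nil => simp [Visits]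
  | cons c l ih =>
    simp only [List.cons_append, Visits, ih]
    constructor
    · rintro ⟨m, h1, h2, m', h3, h4⟩
      exact ⟨m', ⟨m, h1, h2, h3⟩, h4⟩
    · rintro ⟨m', ⟨m, h1, h2, h3⟩, h4⟩
      exact ⟨m, h1, h2, m', h3, h4⟩

lemma forall_mem_Icc_of_split {P : I → Prop} {a b c : I} (h₁ : ∀ r ∈ Icc a b, P r)
    (h₂ : ∀ r ∈ Icc b c, P r) : ∀ r ∈ Icc a c, P r := fun r hr =>
  (le_total r b).elim (fun h => h₁ r ⟨hr.1, h⟩) fun h => h₂ r ⟨h, hr.2⟩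

lemma Visits.remove_repetition {u v : List ι} {x : ι} {s e : I}
    (h : Visits cell p (u ++ x :: x :: v) s e) : Visits cell p (u ++ x :: v) s e := by
  rw [visits_append] at h ⊢
  obtain ⟨m, h, m₁, h1, h1', m₂, h2, h2', h3⟩ := h
  exact ⟨m, h, m₂, h1.trans h2, forall_mem_Icc_of_split h1' h2', h3⟩

lemma visits_of_times : ∀ (l : List ι) (t : ℕ → I), Monotone t →
    (∀ (k : ℕ) (hk : k < l.length), ∀ s ∈ Icc (t k) (t (k + 1)), p s ∈ cell l[k]) →
    Visits cell p l (t 0) (t l.length)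
  | [], _, _, _ => rfl
  | c :: l, t, ht, h => ⟨t 1, ht zero_le_one, h 0 (by simp), visits_of_times l (fun k => t (k + 1))
      (fun _ _ hab => ht (by omega)) fun k hk => h (k + 1) (by simpa using hk)⟩

lemma Visits.exists_times : ∀ {l : List ι} {s e : I}, Visits cell p l s e →
    ∃ t : ℕ → I, Monotone t ∧ t 0 = s ∧ t l.length = e ∧
      ∀ (k : ℕ) (hk : k < l.length), ∀ s ∈ Icc (t k) (t (k + 1)), p s ∈ cell l[k]
  | [], s, e, h => ⟨fun _ => s, monotone_const, rfl, h, by simp⟩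
  | c :: l, s, e, ⟨m, hsm, hm, h⟩ => by
    obtain ⟨t, ht, ht0, hte, htc⟩ := h.exists_times
    refine ⟨fun k => Nat.casesOn k s t, monotone_nat_of_le_succ ?_, rfl, hte, ?_⟩
    · rintro (_ | k)
      · simpa [ht0] using hsm
      · exact ht k.le_succ
    · rintro (_ | k) hk r hr
      · exact hm r (by simpa [ht0] using hr)
      · exact htc k (by simpa using hk) r hr

/-- From the cell `c` at time `s` the curve gets to the cell `d` at time `e` along a graph path. -/
def Reaches (G : SimpleGraph ι) (cell : ι → Set E) (p : I → E) (s : I) (c : ι) (e : I) (d : ι) :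
    Prop :=
  ∃ l, IsTopoPath G l ∧ l.head? = some c ∧ l.getLast? = some d ∧ Visits cell p l s e

variable {G : SimpleGraph ι}

lemma Reaches.of_forall_mem {s e : I} {c : ι} (hse : s ≤ e) (h : ∀ r ∈ Icc s e, p r ∈ cell c) :
    Reaches G cell p s c e c :=
  ⟨[c], ⟨by simp, by simp⟩, rfl, rfl, e, hse, h, rfl⟩

lemma Reaches.trans {s m e : I} {c d k : ι} (h : Reaches G cell p s c m d)
    (h' : Reaches G cell p m d e k) : Reaches G cell p s c e k := by
  obtain ⟨l, hl, hc, hd, hv⟩ := h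
  obtain ⟨l', hl', hc', hd', hv'⟩ := h'
  refine ⟨l ++ l', ⟨by simp [hl.1], ?_⟩, ?_, ?_, visits_append.2 ⟨m, hv, hv'⟩⟩
  · rw [List.isChain_append]
    refine ⟨hl.2, hl'.2, fun x hx y hy => ?_⟩
    rw [hd] at hx
    rw [hc'] at hy
    exact .inl ((Option.mem_some.1 hx).symm.trans (Option.mem_some.1 hy))
  · simp [List.head?_append, hc]
  · simp [List.getLast?_append, hd']

lemma Reaches.of_adj {s : I} {c d : ι} (h : G.Adj c d) (hc : p s ∈ cell c) (hd : p s ∈ cell d) :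
    Reaches G cell p s c s d := by
  refine ⟨[c, d], ⟨by simp, by simp [h]⟩, rfl, rfl, s, le_rfl, fun r hr => ?_, s, le_rfl,
    fun r hr => ?_, rfl⟩
  · rwa [le_antisymm hr.2 hr.1]
  · rwa [le_antisymm hr.2 hr.1]

end Visits

namespace ConvexDivision

variable {X : FreeSpace} {ι : Type*} (D : ConvexDivision X ι) {x y : X.carrier}

/-- The cells as subsets of the free space. -/
def subcell (c : ι) : Set X.carrier := Subtype.val ⁻¹' D.cell c

lemma isClosed_subcell (c : ι) : IsClosed (D.subcell c) :=
  (D.isClosed_cell c).preimage continuous_subtype_val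

lemma eventually_subcell (z : X.carrier) :
    ∀ᶠ z' in 𝓝 z, ∀ c, z' ∈ D.subcell c → z ∈ D.subcell c :=
  continuous_subtype_val.continuousAt.eventually (D.eventually_star z)

lemma exists_mem_subcell (z : X.carrier) : ∃ c, z ∈ D.subcell c := D.exists_mem_cell z.2

lemma traverses_iff {a b : ι} {f : Path x y} {l : List ι} : D.Traverses a b f l ↔
    IsTopoPath D.graph l ∧ l.head? = some a ∧ l.getLast? = some b ∧ Visits D.subcell f l 0 1 := by
  refine and_congr_right fun _ => and_congr_right fun _ => and_congr_right fun _ => ?_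
  constructor
  · rintro ⟨t, ht, h0, h1, h⟩
    have := visits_of_times (cell := D.subcell) (p := f) l t ht h
    rwa [h0, h1] at this
  · intro h
    exact h.exists_times

lemma reaches_star {p : I → X.carrier} {s : I} {c d : ι} (hc : p s ∈ D.subcell c)
    (hd : p s ∈ D.subcell d) : Reaches D.graph D.subcell p s c s d := by
  have h := D.reflTransGen_star hc hd
  induction h with
  | refl => exact .of_forall_mem le_rfl fun r hr => by rwa [le_antisymm hr.2 hr.1]
  | tail _ h ih => exact (ih h.2.1).trans (.of_adj h.1 h.2.1 h.2.2)

/-- If a curve is in each cell during a time interval only, then it passes finitely many cells: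
it leaves the present cell for one that it has not visited before. -/
lemma reaches_of_ordConnected {p : I → X.carrier} (hp : Continuous p) {u w : I}
    (hconv : ∀ c, ∀ s ∈ Icc u w, ∀ s' ∈ Icc u w, s ≤ s' → p s ∈ D.subcell c →
      p s' ∈ D.subcell c → ∀ r ∈ Icc s s', p r ∈ D.subcell c) {d : ι} (hd : p w ∈ D.subcell d) :
    ∀ s ∈ Icc u w, ∀ c, p s ∈ D.subcell c → Reaches D.graph D.subcell p s c w d := by
  have := D.finite_cells
  -- induction on the number of cells still to be visited
  suffices H : ∀ (n : ℕ), ∀ s ∈ Icc u w, {k | ∃ t ∈ Ioc s w, p t ∈ D.subcell k}.ncard = n →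
      ∀ c, p s ∈ D.subcell c → Reaches D.graph D.subcell p s c w d from
    fun s hs c hc => H _ s hs rfl c hc
  intro n
  induction n using Nat.strong_induction_on with
  | _ n ih =>
    intro s hs hn c hc
    rcases hs.2.eq_or_lt with rfl | hsw
    · exact D.reaches_star hc hd
    obtain ⟨t₀, ht₀, ht₀'⟩ : ∃ t₀ ∈ Ioc s w, ∀ k, p t₀ ∈ D.subcell k → p s ∈ D.subcell k := by
      have hne : (𝓝[>] s).NeBot := nhdsGT_neBot_of_exists_gt ⟨w, hsw⟩
      obtain ⟨t, h1, h2⟩ := (((hp.continuousAt.eventually (D.eventually_subcell (p s))).filter_mono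
        nhdsWithin_le_nhds).and (Ioc_mem_nhdsGT hsw)).exists
      exact ⟨t, h2, h1⟩
    obtain ⟨k, hk⟩ := D.exists_mem_subcell (p t₀)
    -- go to a cell `k` that is visited shortly after `s`, and stay there until the last visit
    have hcomp : IsCompact (Icc s w ∩ p ⁻¹' D.subcell k) :=
      isCompact_Icc.inter_right ((D.isClosed_subcell k).preimage hp)
    obtain ⟨v, ⟨hv, hvk⟩, hvmax⟩ := hcomp.exists_isGreatest ⟨t₀, ⟨ht₀.1.le, ht₀.2⟩, hk⟩
    have hvuw : v ∈ Icc u w := ⟨hs.1.trans hv.1, hv.2⟩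
    refine (D.reaches_star hc (ht₀' k hk)).trans ((Reaches.of_forall_mem hv.1
      (hconv k s hs v hvuw hv.1 (ht₀' k hk) hvk)).trans (ih _ ?_ v hvuw rfl k hvk))
    rw [← hn]
    refine ncard_lt_ncard ⟨?_, fun hsub => ?_⟩ (toFinite _)
    · rintro j ⟨t, ht, hj⟩
      exact ⟨t, ⟨hv.1.trans_lt ht.1, ht.2⟩, hj⟩
    · obtain ⟨t, ht, htk⟩ := hsub ⟨t₀, ht₀, hk⟩
      exact absurd (hvmax ⟨⟨hv.1.trans ht.1.le, ht.2⟩, htk⟩) (not_le.2 ht.1)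

variable {a b : ι}

/-- A shortest path in its homotopy class changes cells only finitely often: in a star-shaped
neighbourhood it is straight between any two visits to the same cell. -/
lemma exists_traverses (ha : (x : Plane) ∈ D.cell a) (hb : (y : Plane) ∈ D.cell b)
    {g f : Path x y} (hg : IsLocallyOptimal g f) : ∃ l, D.Traverses a b g l := by
  choose r hr hstar hcell using fun t : I => D.exists_starConvex (g t : Plane)
  obtain ⟨t, ht0, htm, ⟨N, hN⟩, ht⟩ := exists_monotone_Icc_subset_open_cover_unitInterval
    (c := fun s : I => {u : I | (g u : Plane) ∈ Metric.ball (g s : Plane) (r s)})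
    (fun s => Metric.isOpen_ball.preimage (by fun_prop))
    (fun s _ => mem_iUnion.2 ⟨s, Metric.mem_ball_self (hr s)⟩)
  have hpiece : ∀ n c d, g (t n) ∈ D.subcell c → g (t (n + 1)) ∈ D.subcell d →
      Reaches D.graph D.subcell g (t n) c (t (n + 1)) d := by
    intro n c d hc hd
    obtain ⟨z, hz⟩ := ht n
    refine D.reaches_of_ordConnected g.continuous (fun k s hs s' hs' hss hk hk' q hq => ?_) hd
      (t n) (left_mem_Icc.2 (htm n.le_succ)) c hc
    have hsegc := D.segment_subset_cell hk hk'
    refine hsegc (hg.mem_segment D (hstar z) inter_subset_left hss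
      (fun q hq => ⟨(g q).2, hz ⟨hs.1.trans hq.1, hq.2.trans hs'.2⟩⟩) ?_ q hq)
    exact subset_inter (hsegc.trans (D.cell_subset_carrier k))
      ((convex_ball _ _).segment_subset (hz hs) (hz hs'))
  have hall : ∀ n d, g (t n) ∈ D.subcell d → Reaches D.graph D.subcell g 0 a (t n) d := by
    intro n
    induction n with
    | zero =>
      intro d hd
      rw [ht0] at hd ⊢
      exact D.reaches_star (by rw [g.source]; exact ha) hd
    | succ n ih =>
      intro d hd
      obtain ⟨c, hc⟩ := D.exists_mem_subcell (g (t n))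
      exact (ih c hc).trans (hpiece n c d hc hd)
  obtain ⟨l, h1, h2, h3, h4⟩ := hall N b (by rw [hN N le_rfl, g.target]; exact hb)
  rw [hN N le_rfl] at h4
  exact ⟨l, D.traverses_iff.2 ⟨h1, h2, h3, h4⟩⟩

lemma exists_isGamma {g : Path x y} (h : ∃ l, D.Traverses a b g l) : ∃ l, D.IsGamma a b g l := by
  classical
  have h' : ∃ n, ∃ l, D.Traverses a b g l ∧ l.length = n :=
    h.imp' List.length fun l hl => ⟨l, hl, rfl⟩
  obtain ⟨l, hl, hn⟩ := Nat.find_spec h'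
  exact ⟨l, hl, fun l' hl' => hn ▸ Nat.find_min' h' ⟨l', hl', rfl⟩⟩

/-- A shortest path does not return to a cell through the cutline by which it has left it, except
along this cutline: then it never needed to leave the cell. -/
lemma visits_remove_backtrack {g f : Path x y} (hg : IsLocallyOptimal g f) {u v : List ι}
    {c d : ι} {s e : I} (h : Visits D.subcell g (u ++ c :: d :: c :: v) s e) :
    Visits D.subcell g (u ++ c :: v) s e := by
  rw [visits_append] at h ⊢
  obtain ⟨m, h, m₁, h1, h1', m₂, h2, h2', m₃, h3, h3', h4⟩ := h
  refine ⟨m, h, m₃, (h1.trans h2).trans h3, forall_mem_Icc_of_split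
    (forall_mem_Icc_of_split h1' fun r hr => ?_) h3', h4⟩
  have hd1 := h2' m₁ (left_mem_Icc.2 h2)
  have hd2 := h2' m₂ (right_mem_Icc.2 h2)
  have := hg.mem_segment D ((D.convex_cell d).starConvex hd1) (D.cell_subset_carrier d) h2 h2'
    (D.segment_subset_cell hd1 hd2) r hr
  exact D.segment_subset_cell (h1' m₁ (right_mem_Icc.2 h1)) (h3' m₂ (left_mem_Icc.2 h3)) this

lemma noRollback_of_isGamma {g f : Path x y} (hg : IsLocallyOptimal g f) {l : List ι}
    (hl : D.IsGamma a b g l) : NoRollback D.graph l := by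
  obtain ⟨htr, hmin⟩ := hl
  have htr' := D.traverses_iff.1 htr
  obtain ⟨hp, hh, hlast, hv⟩ := htr'
  refine noRollback_iff.2 ⟨hp, ?_, ?_⟩
  · by_contra hc
    obtain ⟨u, c, v, rfl⟩ := exists_repetition_of_not_isChain_ne hc
    have := hmin (u ++ c :: v) (D.traverses_iff.2 ⟨hp.remove_repetition,
      by cases u <;> simpa using hh, by simpa [List.getLast?_append] using hlast,
      hv.remove_repetition⟩)
    simp at this
  · rintro u c d v rfl
    have := hmin (u ++ c :: v) (D.traverses_iff.2 ⟨hp.remove_backtrack,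
      by cases u <;> simpa using hh, by simpa [List.getLast?_append] using hlast,
      D.visits_remove_backtrack hg hv⟩)
    simp at this

/-- The cell sequences of homotopic paths have the same product of labels. -/
lemma walkElt_eq_of_traverses (ha : (x : Plane) ∈ D.cell a) (hb : (y : Plane) ∈ D.cell b)
    {F : Type*} [Group F] {e : ι → ι → F} (hself : ∀ c, e c c = 1)
    (hinv : ∀ c d, e c d * e d c = 1) {p q : Path x y} (hpq : p.Homotopic q) {l l' : List ι}
    (hl : D.Traverses a b p l) (hl' : D.Traverses a b q l') : walkElt e l = walkElt e l' := by
  choose φ hφ using fun z : X.carrier => D.exists_potential hinv (z : Plane)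
  obtain ⟨h1, h2, h3, h4⟩ := D.traverses_iff.1 hl
  obtain ⟨h1', h2', h3', h4'⟩ := D.traverses_iff.1 hl'
  refine walkElt_eq_of_homotopic (cell := D.subcell) (φ := φ) (G := D.graph) hself
    (fun z c c' h hc hc' => hφ z c c' h hc hc') ?_ D.eventually_subcell D.exists_mem_subcell hpq
    ha hb h1 h2 h3 h1' h2' h3' h4 h4'
  intro z z' c c' hz hz1 hz' hz1'
  by_cases hcc : c = c'
  · subst hcc; simp
  -- different cells with two common points share a cutline, and its label is the difference of
  -- either potential
  by_cases hzz : z = z'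
  · subst hzz; rfl
  have hadj : D.graph.Adj c c' :=
    ⟨hcc, z, ⟨hz, hz1⟩, z', ⟨hz', hz1'⟩, fun h => hzz (Subtype.ext h)⟩
  rw [← hφ z c c' hadj hz hz1, ← hφ z' c c' hadj hz' hz1']

end ConvexDivision

theorem mainTheorem4 (X : FreeSpace) {ι : Type*} (D : ConvexDivision X ι) {x y : X.carrier}
    (a b : ι) (ha : (x : Plane) ∈ D.cell a) (hb : (y : Plane) ∈ D.cell b)
    (f fstar : Path x y) (hopt : IsLocallyOptimal fstar f) :
    ∃ s : List ι, (∀ l, D.IsGamma a b fstar l ↔ l = s) ∧ NoRollback D.graph s ∧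
      ∀ g : Path x y, g.Homotopic f → (∃ l, D.IsGamma a b g l) →
        ∀ r, D.IsGammaStar a b g r ↔ r = s := by
  obtain ⟨F, _, e, hself, hinv, hinj⟩ := exists_labelling ι
  obtain ⟨s, hs⟩ := D.exists_isGamma (D.exists_traverses ha hb hopt)
  have hsn := D.noRollback_of_isGamma hopt hs
  have huniq : ∀ r : List ι, NoRollback D.graph r → r.head? = some a →
      walkElt e r = walkElt e s → r = s := by
    intro r hr hra hrs
    obtain ⟨h1, h2, h3⟩ := noRollback_iff.1 hr
    obtain ⟨-, h2', h3'⟩ := noRollback_iff.1 hsn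
    exact hinj r s h1.1 (hra.trans hs.1.2.1.symm) h2 h2' h3 h3' hrs
  have hstar : ∀ g : Path x y, g.Homotopic f → ∀ l, D.IsGamma a b g l → ∀ r,
      NoRollback D.graph r → TopoHomotopic D.graph l r → r = s := by
    intro g hg l hl r hr hlr
    refine huniq r hr (hlr.head?_eq ▸ hl.1.2.1) ?_
    rw [← walkElt_topoHomotopic e D.graph hself hinv hlr]
    exact D.walkElt_eq_of_traverses ha hb hself hinv (hg.trans hopt.1.symm) hl.1 hs.1
  refine ⟨s, fun l => ⟨fun hl => ?_, fun hl => hl ▸ hs⟩, hsn, fun g hg hgl r => ⟨?_, ?_⟩⟩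
  · exact huniq l (D.noRollback_of_isGamma hopt hl) hl.1.2.1
      (D.walkElt_eq_of_traverses ha hb hself hinv (.refl _) hl.1 hs.1)
  · rintro ⟨l, hl, hr, hlr⟩
    exact hstar g hg l hl r hr hlr
  · rintro rfl
    obtain ⟨l, hl⟩ := hgl
    obtain ⟨r, hr, hlr⟩ := exists_noRollback_topoHomotopic l hl.1.1
    obtain rfl := hstar g hg l hl r hr hlr
    exact ⟨l, hl, hr, hlr⟩
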